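/- Let $0<\gamma<1$, $A<0$, $u_0>0$ and $p\in\mathbb R$, and consider the fractional initial value problem $$D_c^{\gamma}u=Au^p,\qquad u(0)=u_0,\qquad\text{with } u \text{ taking values in } (0,\infty). \tag{1}$$ Here, for $u\in L^1(0,T)$ with right limit $u(0+)$, meaning $\lim_{t\to0+}\frac1t\int_0^t|u(s)-u(0+)|\,ds=0$, the generalized Caputo derivative is the distribution on $(-\infty,T)$ $$D_c^\gamma u=g_{-\gamma}*\big((u-u(0+))\theta\big),\qquad g_{-\gamma}=\frac{1}{\Gamma(1-\gamma)}\,\frac{d}{dt}\big(\theta(t)t^{-\gamma}\big),$$ where $\theta$ is the Heaviside function and $\frac{d}{dt}$ is the distributional derivative. A strong solution of (1) on $(0,T)$, $T<\infty$, is a function $u\in L^1(0,T)$ with $u(0+)=u_0$ that satisfies the equation in the sense of distributions on $(-\infty,T)$ (the right-hand side being extended by $0$ to $t<0$), for which $D_c^\gamma u\in L^1(0,T)$ and the equation holds almost everywhere on $(0,T)$. A continuous strong solution on $(0,b)$, $0<b\le\infty$, is a continuous function $u:[0,b)\to(0,\infty)$ with $u(0)=u_0$ that is a strong solution on $(0,T)$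 for every $0<T<b$, $T<\infty$. Then there exist $T_b\in(0,\infty]$ and a continuous strong solution $u$ of (1) on $(0,T_b)$ such that every continuous strong solution $v$ of (1) on an interval $(0,b)$ satisfies $b\le T_b$ and $v=u$ on $[0,b)$; that is, $u$ is the unique solution and $(0,T_b)$ is its maximal interval of existence. Moreover, $0<u(t)<u_0$ for all $t\in(0,T_b)$, $u$ is strictly decreasing on $(0,T_b)$, and $$\lim_{t\to T_b^-}u(t)=0.$$ -/

import Mathlib

open MeasureTheory Set Filter Topology

noncomputable section

namespace FracODE

/-- The interval `(-∞, T)` as an open subset of the real line. -/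
def leftRay (T : ℝ) : TopologicalSpace.Opens ℝ := ⟨Iio T, isOpen_Iio⟩

/-- `a` is the right limit `u(0+)` of `u`: the means `(1/t) ∫₀ᵗ |u(s) - a| ds` tend to `0` as
`t → 0+` (and `u` is integrable near `0`, so that these integrals make sense). -/
def HasRightLimitAtZero (u : ℝ → ℝ) (a : ℝ) : Prop :=
  (∀ᶠ t in 𝓝[>] (0 : ℝ), IntegrableOn u (Ioo 0 t)) ∧
    Tendsto (fun t : ℝ => (1 / t) * ∫ s in Ioo 0 t, |u s - a|) (𝓝[>] 0) (𝓝 0)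

/-- The distribution `g_{-γ} = (1 / Γ(1-γ)) D(θ(t) t^{-γ})`, for `0 < γ < 1`, applied to a test
function `φ`; here `D` is the distributional derivative and `θ` the Heaviside function, so that
`⟨g_{-γ}, φ⟩ = -(1 / Γ(1-γ)) ∫₀^∞ t^{-γ} φ'(t) dt`. -/
def gNeg (γ : ℝ) (φ : ℝ → ℝ) : ℝ :=
  -(1 / Real.Gamma (1 - γ)) * ∫ t in Ioi (0 : ℝ), t ^ (-γ) * deriv φ t

/-- The generalized Caputo derivative `D_c^γ u = g_{-γ} * ((u - u(0+)) θ)`, a distribution on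
`(-∞, T)`, applied to a test function `φ`, for `u ∈ L¹(0, T)` with right limit `u₀ = u(0+)`.
The convolution of distributions is `⟨g * v, φ⟩ = ∫ v(s) ⟨g, φ(· + s)⟩ ds`; since `φ` vanishes on
`[T, ∞)`, only the values of `u` on `(0, T)` matter. -/
def caputo (γ T u₀ : ℝ) (u : ℝ → ℝ) (φ : TestFunction (leftRay T) ℝ (⊤ : ℕ∞)) : ℝ :=
  ∫ s in Ioo 0 T, (u s - u₀) * gNeg γ (fun t => φ (t + s))

/-- `u` is a weak solution on `(0, T)`, `0 < T < ∞`, of `D_c^γ u = f(u)`, `u(0) = u₀`, where the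
domain of `f` is the set `I`. -/
structure IsWeakSolution (γ : ℝ) (f : ℝ → ℝ) (I : Set ℝ) (u₀ T : ℝ) (u : ℝ → ℝ) : Prop where
  integrable : IntegrableOn u (Ioo 0 T)
  rightLimit : HasRightLimitAtZero u u₀
  mem_domain : ∀ᵐ t ∂(volume.restrict (Ioo 0 T)), u t ∈ I
  /-- `θ f(u)` is a distribution on `(-∞, T)`. -/
  rhs_locallyIntegrable : LocallyIntegrableOn (fun t => f (u t)) (Ico 0 T)
  equation : ∀ φ : TestFunction (leftRay T) ℝ (⊤ : ℕ∞),
    caputo γ T u₀ u φ = ∫ t in Ioo 0 T, f (u t) * φ t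

/-- `u` is a strong solution on `(0, T)`, `0 < T < ∞`: a weak solution such that the distribution
`D_c^γ u` is a function `w ∈ L¹(0, T)` and `w = f(u)` almost everywhere on `(0, T)`. -/
structure IsStrongSolution (γ : ℝ) (f : ℝ → ℝ) (I : Set ℝ) (u₀ T : ℝ) (u : ℝ → ℝ) : Prop
    extends IsWeakSolution γ f I u₀ T u where
  strong : ∃ w : ℝ → ℝ, IntegrableOn w (Ioo 0 T) ∧
    (∀ φ : TestFunction (leftRay T) ℝ (⊤ : ℕ∞),
      caputo γ T u₀ u φ = ∫ t in Ioo 0 T, w t * φ t) ∧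
    ∀ᵐ t ∂(volume.restrict (Ioo 0 T)), w t = f (u t)

/-- `u` is a continuous strong solution of `D_c^γ u = f(u)`, `u(0) = u₀`, with values in the
domain `I` of `f`, on the interval of existence `[0, b)`, `0 < b ≤ ∞`: it is continuous on `[0, b)`
with `u(0) = u₀`, and a strong solution on `(0, T)` for every real `T` with `0 < T < b`. -/
structure IsContinuousStrongSolution (γ : ℝ) (f : ℝ → ℝ) (I : Set ℝ) (u₀ : ℝ) (b : EReal)
    (u : ℝ → ℝ) : Prop where
  initial : u 0 = u₀
  continuousOn : ContinuousOn u {t : ℝ | 0 ≤ t ∧ (t : EReal) < b}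
  mem_domain : ∀ t : ℝ, 0 ≤ t → (t : EReal) < b → u t ∈ I
  strong : ∀ T : ℝ, 0 < T → (T : EReal) < b → IsStrongSolution γ f I u₀ T u

end FracODE

end

noncomputable section

namespace FracODE

/-! For continuous `u` the Caputo equation is equivalent to the Volterra equation `u = u₀ + g_γ * (A
u^p)` with kernel `t^(γ-1) / Γ(γ)` (`caputo_eq_of_volterra`, `volterra_of_caputo_eq`). Kernels of
orders `γ` and `1 - γ` convolve to a constant, so on the test-function side a fractional integral of
order `γ` undoes `g_{-γ}`.

The possible singularity of `x^p` at `0` is removed by clamping the argument to `[ε, u₀]`. The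
clamped nonlinearity is bounded, Lipschitz, monotone in one direction and below a negative constant.
Its Volterra equation therefore has a unique global solution (contraction in an exponentially
weighted norm), which decreases strictly and reaches `ε` at a finite time; until then the clamp is
inactive. Conversely, a positive solution never exceeds `u₀` and on a compact interval stays above
some `ε`, so it is one of these. As `ε → 0` the clamped solutions extend one another, `T_b` is the
supremum of the hitting times, and the limit is `0` because `u < ε` after the hitting time of `ε`.

The delicate point is strict decrease, since a nonlocal equation cannot be restarted at a later
time. The difference `u(t) - u(t+h)` solves a Volterra equation with positive forcing. If the
nonlinearity is nondecreasing, the memory term only helps. If it is nonincreasing, that term is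
dissipative, and a first zero is excluded by comparing the kernel at that time with a rescaled
kernel at a slightly earlier time (`volterra_pos_at_endpoint`). -/

/-- The unnormalised left-sided Riemann-Liouville integral `∫₀ᵗ (t - s)^(a-1) F(s) ds`. -/
def leftInt (a : ℝ) (F : ℝ → ℝ) (t : ℝ) : ℝ :=
  ∫ s in Ioo 0 t, (t - s) ^ (a - 1) * F s

/-- The unnormalised right-sided Riemann-Liouville integral `∫₀^∞ τ^(a-1) ψ(s + τ) dτ`. -/
def rightInt (a : ℝ) (ψ : ℝ → ℝ) (s : ℝ) : ℝ :=
  ∫ τ in Ioi (0 : ℝ), τ ^ (a - 1) * ψ (s + τ)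

/-! ### Power kernels: integrability, duality and composition -/

theorem integrableOn_rpow_sub_one {a : ℝ} (ha : 0 < a) (R : ℝ) :
    IntegrableOn (fun t : ℝ => t ^ (a - 1)) (Ioo 0 R) := by
  rcases le_or_gt R 0 with hR | hR
  · simp [Ioo_eq_empty_of_le hR]
  · have := intervalIntegral.intervalIntegrable_rpow' (a := 0) (b := R) (r := a - 1) (by linarith)
    exact ((intervalIntegrable_iff_integrableOn_Ioo_of_le hR.le).1 this)

theorem integrableOn_sub_rpow {a : ℝ} (ha : 0 < a) (c t : ℝ) :
    IntegrableOn (fun s : ℝ => (t - s) ^ (a - 1)) (Ioo c t) := by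
  rcases le_or_gt t c with hR | hR
  · simp [Ioo_eq_empty_of_le hR]
  · have := (intervalIntegral.intervalIntegrable_rpow' (a := 0) (b := t - c) (r := a - 1)
      (by linarith)).comp_sub_left t
    simp only [sub_zero, sub_sub_cancel] at this
    exact (intervalIntegrable_iff_integrableOn_Ioo_of_le hR.le).1 this.symm

theorem integral_sub_rpow {a : ℝ} (ha : 0 < a) {c t : ℝ} (h : c ≤ t) :
    ∫ s in Ioo c t, (t - s) ^ (a - 1) = (t - c) ^ a / a := by
  rw [← integral_Ioc_eq_integral_Ioo, ← intervalIntegral.integral_of_le h,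
    intervalIntegral.integral_comp_sub_left (fun x => x ^ (a - 1)) t,
    integral_rpow (Or.inl (by linarith))]
  simp [Real.zero_rpow ha.ne']

/-- This is the Beta integral; the scaling factor `x^(a+b-1)` is `1` because `a + b = 1`, so the
value does not depend on `x`. -/
theorem integral_sub_rpow_mul_rpow {a b : ℝ} (ha : 0 < a) (hb : 0 < b) (hab : a + b = 1)
    {x : ℝ} (hx : 0 < x) :
    leftInt b (fun r => r ^ (a - 1)) x = Real.Gamma a * Real.Gamma b := by
  have h1 := Complex.betaIntegral_scaled (a : ℂ) (b : ℂ) hx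
  have h2 := Complex.Gamma_mul_Gamma_eq_betaIntegral (s := (a : ℂ)) (t := (b : ℂ))
    (by simpa using ha) (by simpa using hb)
  have h3 : (a : ℂ) + b = 1 := by exact_mod_cast hab
  rw [h3, Complex.Gamma_one, one_mul] at h2
  rw [h3, sub_self, Complex.cpow_zero, one_mul, ← h2, Complex.Gamma_ofReal,
    Complex.Gamma_ofReal] at h1
  rw [leftInt, ← integral_Ioc_eq_integral_Ioo, ← intervalIntegral.integral_of_le hx.le]
  have h4 : ((∫ s in (0:ℝ)..x, (x - s) ^ (b - 1) * s ^ (a - 1) : ℝ) : ℂ)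
      = ((Real.Gamma a * Real.Gamma b : ℝ) : ℂ) := by
    rw [← intervalIntegral.integral_ofReal, Complex.ofReal_mul, ← h1]
    refine intervalIntegral.integral_congr fun s hs => ?_
    rw [uIcc_of_le hx.le] at hs
    simp only [Complex.ofReal_mul]
    rw [Complex.ofReal_cpow (by linarith [hs.2]), Complex.ofReal_cpow hs.1]
    push_cast
    ring
  exact_mod_cast h4

theorem rightInt_eq_integral_Ioo {b R r : ℝ} {ψ : ℝ → ℝ} (hψ : ∀ x, R ≤ x → ψ x = 0) :
    rightInt b ψ r = ∫ x in Ioo r R, (x - r) ^ (b - 1) * ψ x := by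
  have h1 : rightInt b ψ r = ∫ x in Ioi r, (x - r) ^ (b - 1) * ψ x := by
    rw [rightInt, ← integral_indicator measurableSet_Ioi, ← integral_indicator measurableSet_Ioi,
      ← integral_sub_right_eq_self _ r]
    congr 1
    ext x
    simp [indicator]
  rw [h1]
  refine (setIntegral_eq_of_subset_of_forall_sdiff_eq_zero measurableSet_Ioi
    (fun x hx => hx.1) fun x hx => ?_)
  have : R ≤ x := by
    by_contra! h
    exact hx.2 ⟨hx.1, h⟩
  simp [hψ x this]

/-- Fubini: cut off to `(0, R)`, `F` and the kernel are integrable, so their convolution integrand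
is integrable on the plane, and a bounded `ψ` preserves this. -/
theorem integral_mul_rightInt_of_bounded {b R C : ℝ} (hb : 0 < b) {F ψ : ℝ → ℝ}
    (hF : IntegrableOn F (Ioo 0 R)) (hψc : Continuous ψ) (hψb : ∀ x, |ψ x| ≤ C)
    (hψ : ∀ x, R ≤ x → ψ x = 0) :
    ∫ r in Ioo 0 R, F r * rightInt b ψ r = ∫ x in Ioo 0 R, leftInt b F x * ψ x := by
  set F₁ : ℝ → ℝ := (Ioo 0 R).indicator F
  set k : ℝ → ℝ := (Ioo 0 R).indicator (fun t : ℝ => t ^ (b - 1))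
  have hF₁ : Integrable F₁ := (integrable_indicator_iff measurableSet_Ioo).2 hF
  have hk : Integrable k :=
    (integrable_indicator_iff measurableSet_Ioo).2 (integrableOn_rpow_sub_one hb R)
  have hint : Integrable (fun p : ℝ × ℝ => (F₁ p.2 * k (p.1 - p.2)) * ψ p.1)
      (volume.prod volume) := by
    have h1 := hF₁.convolution_integrand (ContinuousLinearMap.mul ℝ ℝ) hk
    refine h1.mul_bdd (c := C) ?_ ?_
    · exact (hψc.comp continuous_fst).aestronglyMeasurable
    · exact Eventually.of_forall fun p => hψb p.1
  have hsw := integral_integral_swap (f := fun x r => (F₁ r * k (x - r)) * ψ x) hint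
  have hl : ∫ x in Ioo 0 R, leftInt b F x * ψ x = ∫ x, ∫ r, (F₁ r * k (x - r)) * ψ x := by
    rw [← integral_indicator measurableSet_Ioo]
    congr 1
    ext x
    rw [integral_mul_const]
    by_cases hx : x ∈ Ioo 0 R
    · rw [indicator_of_mem hx, leftInt]
      congr 1
      rw [← integral_indicator measurableSet_Ioo]
      congr 1
      ext r
      simp only [F₁, k, indicator, mem_Ioo]
      obtain ⟨hx1, hx2⟩ := hx
      by_cases h1 : 0 < r ∧ r < x
      · rw [if_pos h1, if_pos ⟨h1.1, by linarith⟩, if_pos ⟨by linarith, by linarith⟩, mul_comm]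
      · rw [if_neg h1]
        by_cases h2 : 0 < r ∧ r < R
        · rw [if_pos h2, if_neg, mul_zero]
          rintro ⟨h3, -⟩
          exact h1 ⟨h2.1, by linarith⟩
        · rw [if_neg h2, zero_mul]
    · rw [indicator_of_notMem hx]
      rcases le_or_gt R x with h | h
      · rw [hψ x h, mul_zero]
      · have hx0 : x ≤ 0 := by
          by_contra! h0
          exact hx ⟨h0, h⟩
        have : ∀ r, F₁ r * k (x - r) = 0 := by
          intro r
          simp only [F₁, k, indicator, mem_Ioo]
          by_cases h2 : 0 < r ∧ r < R
          · rw [if_neg (c := 0 < x - r ∧ x - r < R), mul_zero]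
            rintro ⟨h3, -⟩
            linarith [h2.1]
          · rw [if_neg h2, zero_mul]
        simp [this]
  rw [hl, hsw, ← integral_indicator measurableSet_Ioo]
  congr 1
  ext r
  simp only [mul_assoc]
  rw [integral_const_mul]
  by_cases hr : r ∈ Ioo 0 R
  · rw [indicator_of_mem hr]
    simp only [F₁, indicator_of_mem hr]
    congr 1
    rw [rightInt_eq_integral_Ioo hψ, ← integral_indicator measurableSet_Ioo]
    congr 1
    ext x
    simp only [k, indicator, mem_Ioo]
    obtain ⟨hr1, hr2⟩ := hr
    by_cases h1 : r < x ∧ x < R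
    · rw [if_pos h1, if_pos ⟨by linarith, by linarith⟩]
    · rw [if_neg h1]
      by_cases h2 : x < R
      · rw [if_neg, zero_mul]
        rintro ⟨h3, -⟩
        exact h1 ⟨by linarith, h2⟩
      · rw [hψ x (not_lt.1 h2), mul_zero]
  · rw [indicator_of_notMem hr]
    simp only [F₁, indicator_of_notMem hr, zero_mul]

theorem integral_mul_rightInt {b R : ℝ} (hb : 0 < b) {F ψ : ℝ → ℝ}
    (hF : IntegrableOn F (Ioo 0 R)) (hψc : Continuous ψ) (hψ : ∀ x, R ≤ x → ψ x = 0) :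
    ∫ r in Ioo 0 R, F r * rightInt b ψ r = ∫ x in Ioo 0 R, leftInt b F x * ψ x := by
  rcases le_or_gt R 0 with hR | hR
  · simp [Ioo_eq_empty_of_le hR]
  obtain ⟨C, hC⟩ := (isCompact_Icc (a := 0) (b := R)).exists_bound_of_continuousOn hψc.continuousOn
  -- Both sides see `ψ` on positive arguments only, so `ψ` may be frozen to the left of `0`, which
  -- makes it bounded.
  have hb1 : ∀ x, |ψ (max 0 x)| ≤ C := by
    intro x
    rcases le_or_gt R (max 0 x) with h | h
    · rw [hψ _ h, abs_zero]
      exact (norm_nonneg _).trans (hC 0 ⟨le_rfl, hR.le⟩)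
    · exact hC _ ⟨le_max_left _ _, h.le⟩
  have key := integral_mul_rightInt_of_bounded (ψ := fun x => ψ (max 0 x)) hb hF
    (hψc.comp (continuous_const.max continuous_id) : Continuous fun x => ψ (max 0 x)) hb1
    (fun x hx => hψ _ (hx.trans (le_max_right _ _)))
  rw [← setIntegral_congr_fun measurableSet_Ioo
    (f := fun r => F r * rightInt b (fun x => ψ (max 0 x)) r), key]
  · exact setIntegral_congr_fun measurableSet_Ioo fun x hx => by simp [max_eq_right hx.1.le]
  · intro r hr
    simp only [rightInt]
    congr 1
    refine setIntegral_congr_fun measurableSet_Ioi fun x hx => ?_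
    rw [max_eq_right (by linarith [hr.1, mem_Ioi.1 hx])]

/-- Complementary orders compose to ordinary integration: duality with `F r = r^(a-1)` moves the
inner kernel onto the outer one, and the Beta integral is constant. -/
theorem rightInt_rightInt {a b R : ℝ} (ha : 0 < a) (hb : 0 < b) (hab : a + b = 1)
    {ψ : ℝ → ℝ} (hψc : Continuous ψ)
    (hψ : ∀ x, R ≤ x → ψ x = 0) (s : ℝ) :
    rightInt a (rightInt b ψ) s =
      Real.Gamma a * Real.Gamma b * ∫ x in Ioi (0 : ℝ), ψ (s + x) := by
  have hψ' : ∀ x, R - s ≤ x → ψ (s + x) = 0 := fun x hx => hψ _ (by linarith)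
  have hshift : ∀ τ, rightInt b ψ (s + τ) = rightInt b (fun x => ψ (s + x)) τ := by
    intro τ
    simp only [rightInt, add_assoc]
  have hd := integral_mul_rightInt hb (integrableOn_rpow_sub_one ha (R - s))
    (ψ := fun x => ψ (s + x)) (hψc.comp (continuous_const.add continuous_id))
    hψ'
  have hIoi : ∀ g : ℝ → ℝ, (∀ x, R - s ≤ x → g x = 0) →
      ∫ x in Ioi (0 : ℝ), g x = ∫ x in Ioo 0 (R - s), g x := by
    intro g hg
    refine (setIntegral_eq_of_subset_of_forall_sdiff_eq_zero measurableSet_Ioi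
      (fun x hx => hx.1) fun x hx => ?_)
    refine hg x ?_
    by_contra! h
    exact hx.2 ⟨hx.1, h⟩
  have hz : ∀ τ, R - s ≤ τ → rightInt b (fun x => ψ (s + x)) τ = 0 := by
    intro τ hτ
    rw [rightInt_eq_integral_Ioo hψ', Ioo_eq_empty_of_le hτ]
    simp
  rw [rightInt, hIoi _ (fun x hx => by rw [hshift, hz x hx, mul_zero]), hIoi _ hψ',
    ← integral_const_mul]
  simp only [hshift]
  rw [hd]
  refine setIntegral_congr_fun measurableSet_Ioo fun x hx => ?_
  rw [integral_sub_rpow_mul_rpow ha hb hab hx.1]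

/-! ### Continuity of left-sided integrals -/

theorem leftInt_congr {a t : ℝ} {F G : ℝ → ℝ} (h : ∀ s ∈ Ioo 0 t, F s = G s) :
    leftInt a F t = leftInt a G t :=
  setIntegral_congr_fun measurableSet_Ioo fun s hs => by simp only [h s hs]

/-- Rescaling to a fixed interval leaves `t` only in the prefactor and in `F (t * σ)`, so dominated
convergence yields continuity; `max t 0` covers `t ≤ 0`. -/
theorem leftInt_eq_rpow_mul {a : ℝ} (ha : 0 < a) (F : ℝ → ℝ) (t : ℝ) :
    leftInt a F t = (max t 0) ^ a * ∫ σ in Ioo (0 : ℝ) 1, (1 - σ) ^ (a - 1) * F (t * σ) := by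
  rcases le_or_gt t 0 with ht | ht
  · rw [max_eq_right ht, Real.zero_rpow ha.ne', zero_mul, leftInt, Ioo_eq_empty_of_le ht]
    simp
  · rw [max_eq_left ht.le, leftInt, ← integral_Ioc_eq_integral_Ioo,
      ← integral_Ioc_eq_integral_Ioo, ← intervalIntegral.integral_of_le ht.le,
      ← intervalIntegral.integral_of_le zero_le_one]
    have h1 := intervalIntegral.smul_integral_comp_mul_left (a := 0) (b := 1)
      (fun s => (t - s) ^ (a - 1) * F s) t
    rw [mul_zero, mul_one] at h1
    rw [← h1, smul_eq_mul, ← intervalIntegral.integral_const_mul,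
      ← intervalIntegral.integral_const_mul]
    refine intervalIntegral.integral_congr fun σ hσ => ?_
    rw [uIcc_of_le zero_le_one] at hσ
    rw [show t - t * σ = t * (1 - σ) by ring, Real.mul_rpow ht.le (by linarith [hσ.2]),
      Real.rpow_sub_one ht.ne']
    field_simp

theorem continuous_leftInt {a C : ℝ} (ha : 0 < a) {F : ℝ → ℝ} (hF : Continuous F)
    (hb : ∀ x, |F x| ≤ C) : Continuous (leftInt a F) := by
  have h : leftInt a F = fun t => (max t 0) ^ a *
      ∫ σ in Ioo (0 : ℝ) 1, (1 - σ) ^ (a - 1) * F (t * σ) :=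
    funext (leftInt_eq_rpow_mul ha F)
  rw [h]
  refine ((continuous_id.max continuous_const).rpow_const fun _ => Or.inr ha.le).mul ?_
  have hk := integrableOn_sub_rpow ha 0 1
  refine continuous_of_dominated (bound := fun σ => (1 - σ) ^ (a - 1) * C) ?_ ?_ ?_ ?_
  · intro t
    exact hk.aestronglyMeasurable.mul
      (hF.comp (continuous_const.mul continuous_id)).aestronglyMeasurable
  · intro t
    refine (ae_restrict_iff' measurableSet_Ioo).2 (Eventually.of_forall fun σ hσ => ?_)
    have : 0 ≤ (1 - σ) ^ (a - 1) := Real.rpow_nonneg (by linarith [hσ.2]) _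
    rw [Real.norm_eq_abs, abs_mul, abs_of_nonneg this]
    exact mul_le_mul_of_nonneg_left (hb _) this
  · exact hk.mul_const C
  · refine Eventually.of_forall fun σ => ?_
    exact continuous_const.mul (hF.comp (continuous_id.mul continuous_const))

theorem exists_continuous_bounded_extension {T : ℝ} (hT : 0 ≤ T) {w : ℝ → ℝ}
    (hw : ContinuousOn w (Icc 0 T)) :
    ∃ (G : ℝ → ℝ) (C : ℝ), Continuous G ∧ (∀ x, |G x| ≤ C) ∧ ∀ x ∈ Icc 0 T, G x = w x := by
  obtain ⟨C, hC⟩ := isCompact_Icc.exists_bound_of_continuousOn hw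
  refine ⟨fun x => w (projIcc 0 T hT x), C, ?_, fun x => hC _ (projIcc 0 T hT x).2, ?_⟩
  · exact hw.domRestrict.comp continuous_projIcc
  · intro x hx
    simp only [projIcc_of_mem hT hx]

theorem continuousOn_leftInt {a T : ℝ} (ha : 0 < a) (hT : 0 ≤ T) {F : ℝ → ℝ}
    (hF : ContinuousOn F (Icc 0 T)) : ContinuousOn (leftInt a F) (Icc 0 T) := by
  obtain ⟨G, C, hG, hb, he⟩ := exists_continuous_bounded_extension hT hF
  refine (continuous_leftInt ha hG hb).continuousOn.congr fun t ht => leftInt_congr fun s hs => ?_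
  exact (he s ⟨hs.1.le, hs.2.le.trans ht.2⟩).symm

/-! ### Right-sided integrals of smooth functions -/

/-- The kernel with which convolution is the right-sided integral. -/
def rightKernel (b : ℝ) : ℝ → ℝ := (Iio 0).indicator fun t => (-t) ^ (b - 1)

theorem locallyIntegrable_rightKernel {b : ℝ} (hb : 0 < b) :
    LocallyIntegrable (rightKernel b) := by
  rw [locallyIntegrable_iff]
  intro K hK
  obtain ⟨R, hR⟩ := hK.isBounded.subset_ball 0
  have h1 := integrableOn_sub_rpow hb (-R) 0
  have h2 : IntegrableOn (rightKernel b) (Ioo (-R) R) := by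
    rw [rightKernel, integrableOn_indicator_iff measurableSet_Iio]
    refine (h1.congr_fun (g := fun t => (-t) ^ (b - 1)) (fun t _ => by simp)
      measurableSet_Ioo).mono_set ?_
    rintro x ⟨hx1, hx2⟩
    exact ⟨hx2.1, hx1⟩
  refine h2.mono_set (hR.trans ?_)
  rw [Real.ball_eq_Ioo, zero_sub, zero_add]

theorem rightInt_eq_convolution (b : ℝ) (ψ : ℝ → ℝ) :
    rightInt b ψ = convolution (rightKernel b) ψ (ContinuousLinearMap.mul ℝ ℝ) volume := by
  ext s
  rw [rightInt, convolution, ← integral_indicator measurableSet_Ioi, ← integral_neg_eq_self]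
  congr 1
  ext x
  by_cases hx : x < 0 <;> simp [rightKernel, indicator, hx, sub_eq_add_neg]

theorem contDiff_rightInt {b : ℝ} (hb : 0 < b) {ψ : ℝ → ℝ} {n : ℕ∞} (hψ : ContDiff ℝ n ψ)
    (hc : HasCompactSupport ψ) : ContDiff ℝ n (rightInt b ψ) := by
  rw [rightInt_eq_convolution]
  exact hc.contDiff_convolution_right _ (locallyIntegrable_rightKernel hb) hψ

theorem continuous_rightInt {b : ℝ} (hb : 0 < b) {ψ : ℝ → ℝ} (hψ : Continuous ψ)
    (hc : HasCompactSupport ψ) : Continuous (rightInt b ψ) := by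
  rw [rightInt_eq_convolution]
  exact hc.continuous_convolution_right _ (locallyIntegrable_rightKernel hb) hψ

theorem deriv_rightInt {b : ℝ} (hb : 0 < b) {ψ : ℝ → ℝ} (hψ : ContDiff ℝ 1 ψ)
    (hc : HasCompactSupport ψ) : deriv (rightInt b ψ) = rightInt b (deriv ψ) := by
  ext s
  rw [rightInt_eq_convolution, rightInt_eq_convolution]
  exact (hc.hasDerivAt_convolution_right _ (locallyIntegrable_rightKernel hb) hψ s).deriv

theorem rightInt_eq_zero {b R : ℝ} {ψ : ℝ → ℝ} (hψ : ∀ x, R ≤ x → ψ x = 0) {s : ℝ} (hs : R ≤ s) :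
    rightInt b ψ s = 0 := by
  rw [rightInt_eq_integral_Ioo hψ, Ioo_eq_empty_of_le hs]
  simp

/-- A fractional fundamental theorem of calculus: the composed integrals give the full integral of
`ψ'` over `(s, ∞)`, which is `-ψ s`. -/
theorem rightInt_rightInt_deriv {a b R : ℝ} (ha : 0 < a) (hb : 0 < b) (hab : a + b = 1)
    {ψ : ℝ → ℝ} (hψ : ContDiff ℝ 1 ψ) (hc : HasCompactSupport ψ)
    (hR : ∀ x, R ≤ x → deriv ψ x = 0) (s : ℝ) :
    rightInt a (rightInt b (deriv ψ)) s = -(Real.Gamma a * Real.Gamma b * ψ s) := by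
  rw [rightInt_rightInt ha hb hab (hψ.continuous_deriv le_rfl) hR]
  have h1 : ∫ x in Ioi (0 : ℝ), deriv ψ (s + x) = -ψ s := by
    rw [← hc.integral_Ioi_deriv_eq hψ s, ← integral_indicator measurableSet_Ioi,
      ← integral_indicator measurableSet_Ioi,
      ← integral_sub_right_eq_self ((Ioi (0 : ℝ)).indicator fun x => deriv ψ (s + x)) s]
    congr 1
    ext x
    simp [indicator]
  rw [h1]
  ring

/-! ### Equivalence of the distributional and the Volterra equation -/

theorem gNeg_comp_add (γ : ℝ) (φ : ℝ → ℝ) (s : ℝ) :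
    gNeg γ (fun t => φ (t + s)) = -(1 / Real.Gamma (1 - γ)) * rightInt (1 - γ) (deriv φ) s := by
  rw [gNeg, rightInt]
  congr 1
  refine setIntegral_congr_fun measurableSet_Ioi fun t _ => ?_
  rw [deriv_comp_add_const, show 1 - γ - 1 = -γ by ring, add_comm]

theorem eq_zero_of_le_of_tsupport_subset {T : ℝ} {φ : ℝ → ℝ} (h : tsupport φ ⊆ Iio T) {x : ℝ}
    (hx : T ≤ x) : φ x = 0 :=
  image_eq_zero_of_notMem_tsupport fun hm => absurd (h hm) (not_lt.2 hx)

/-- The Volterra integral equation `u = u₀ + g_γ * F`, `F = f ∘ u`, implies the distributional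
equation. -/
theorem caputo_eq_of_volterra {γ T u₀ : ℝ} (hγ0 : 0 < γ) (hγ1 : γ < 1) {u F : ℝ → ℝ}
    (hF : IntegrableOn F (Ioo 0 T))
    (hu : ∀ t ∈ Ioo 0 T, u t = u₀ + 1 / Real.Gamma γ * leftInt γ F t)
    (φ : TestFunction (leftRay T) ℝ (⊤ : ℕ∞)) :
    caputo γ T u₀ u φ = ∫ t in Ioo 0 T, F t * φ t := by
  have hΓ := (Real.Gamma_pos_of_pos hγ0).ne'
  have hΓ' := (Real.Gamma_pos_of_pos (sub_pos.2 hγ1)).ne'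
  have hφ1 : ContDiff ℝ 1 φ := φ.contDiff.of_le (by exact_mod_cast le_top)
  have hsupp : tsupport (deriv φ) ⊆ Iio T := (tsupport_deriv_subset (𝕜 := ℝ)).trans φ.tsupport_subset
  have hz : ∀ x, T ≤ x → deriv φ x = 0 := fun x hx => eq_zero_of_le_of_tsupport_subset hsupp hx
  have hdc : Continuous (deriv φ) := hφ1.continuous_deriv le_rfl
  -- Duality moves the kernel of order `γ` from `F` to the test function, where it cancels the one
  -- of order `1 - γ` up to Gamma factors.
  have hd := integral_mul_rightInt hγ0 hF
    (continuous_rightInt (sub_pos.2 hγ1) hdc φ.hasCompactSupport.deriv)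
    (fun x hx => rightInt_eq_zero hz hx)
  have h1 : caputo γ T u₀ u φ = ∫ s in Ioo 0 T, -(1 / (Real.Gamma γ * Real.Gamma (1 - γ))) *
      (leftInt γ F s * rightInt (1 - γ) (deriv φ) s) := by
    refine setIntegral_congr_fun measurableSet_Ioo fun s hs => ?_
    rw [gNeg_comp_add, hu s hs]
    field_simp
    ring
  rw [h1, integral_const_mul, ← hd, ← integral_const_mul]
  refine setIntegral_congr_fun measurableSet_Ioo fun s hs => ?_
  rw [rightInt_rightInt_deriv hγ0 (sub_pos.2 hγ1) (by ring) hφ1 φ.hasCompactSupport hz]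
  field_simp

theorem hasRightLimitAtZero_of_continuousOn {T : ℝ} (hT : 0 < T) {u : ℝ → ℝ}
    (hu : ContinuousOn u (Icc 0 T)) : HasRightLimitAtZero u (u 0) := by
  have hmem : Ioc 0 T ∈ 𝓝[>] (0 : ℝ) := Ioc_mem_nhdsGT hT
  constructor
  · filter_upwards [hmem] with t ht
    exact (hu.integrableOn_Icc).mono_set fun x hx => ⟨hx.1.le, hx.2.le.trans ht.2⟩
  · rw [Metric.tendsto_nhds]
    intro ε hε
    have h0 := Metric.continuousWithinAt_iff.1 (hu 0 ⟨le_rfl, hT.le⟩) (ε / 2) (by positivity)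
    obtain ⟨δ, hδ, h0⟩ := h0
    filter_upwards [hmem, Ioo_mem_nhdsGT hδ] with t ht ht'
    have hb : ‖∫ s in Ioo 0 t, |u s - u 0|‖ ≤ ε / 2 * volume.real (Ioo 0 t) := by
      refine norm_setIntegral_le_of_norm_le_const (by simp) fun s hs => ?_
      have := h0 (x := s) ⟨hs.1.le, hs.2.le.trans ht.2⟩
        (by rw [Real.dist_eq, sub_zero, abs_of_pos hs.1]; exact hs.2.trans ht'.2)
      rw [Real.norm_eq_abs, abs_abs]
      exact this.le
    rw [Real.volume_real_Ioo_of_le ht.1.le, sub_zero] at hb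
    have hp : 0 < 1 / t := one_div_pos.2 ht.1
    rw [dist_zero_right, norm_mul, Real.norm_of_nonneg hp.le]
    calc 1 / t * ‖∫ s in Ioo 0 t, |u s - u 0|‖ ≤ 1 / t * (ε / 2 * t) := by gcongr
      _ = ε / 2 := by have := ht.1.ne'; field_simp
      _ < ε := by linarith

theorem isStrongSolution_of_volterra {γ T u₀ : ℝ} (hγ0 : 0 < γ) (hγ1 : γ < 1) (hT : 0 < T)
    {u f : ℝ → ℝ} {I : Set ℝ} (h0 : u 0 = u₀) (hu : ContinuousOn u (Icc 0 T))
    (hf : ContinuousOn (fun t => f (u t)) (Icc 0 T)) (hI : ∀ t ∈ Icc 0 T, u t ∈ I)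
    (heq : ∀ t ∈ Ioo 0 T, u t = u₀ + 1 / Real.Gamma γ * leftInt γ (fun s => f (u s)) t) :
    IsStrongSolution γ f I u₀ T u := by
  have hFi : IntegrableOn (fun t => f (u t)) (Ioo 0 T) :=
    hf.integrableOn_Icc.mono_set Ioo_subset_Icc_self
  have key := caputo_eq_of_volterra hγ0 hγ1 hFi heq
  refine ⟨⟨hu.integrableOn_Icc.mono_set Ioo_subset_Icc_self,
    h0 ▸ hasRightLimitAtZero_of_continuousOn hT hu, ?_, ?_, key⟩,
    ⟨_, hFi, key, Eventually.of_forall fun _ => rfl⟩⟩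
  · exact (ae_restrict_iff' measurableSet_Ioo).2
      (Eventually.of_forall fun t ht => hI t (Ioo_subset_Icc_self ht))
  · exact (hf.integrableOn_Icc.mono_set Ico_subset_Icc_self).locallyIntegrableOn

/-- A smooth function that vanishes on `(-∞, -1]` and equals `1` on `[0, ∞)`. -/
def leftCutoff (t : ℝ) : ℝ := Real.smoothTransition (t + 1)

/-- A right-sided integral keeps the right end of the support but may spread to `-∞`. A cutoff
acting only on negative times restores compact support without changing any value used for `x ≥ 0`.
-/
theorem exists_testFunction_rightInt {b T : ℝ} (hb : 0 < b) {ψ : ℝ → ℝ}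
    (hψ : ContDiff ℝ (⊤ : ℕ∞) ψ) (hc : HasCompactSupport ψ) (hs : tsupport ψ ⊆ Iio T) :
    ∃ φ : TestFunction (leftRay T) ℝ (⊤ : ℕ∞), ∀ x, 0 ≤ x → φ x = rightInt b ψ x := by
  obtain ⟨R, hRT, hR⟩ : ∃ R < T, ∀ x, R ≤ x → ψ x = 0 := by
    rcases (tsupport ψ).eq_empty_or_nonempty with he | hne
    · exact ⟨T - 1, by linarith, fun x _ => image_eq_zero_of_notMem_tsupport (by simp [he])⟩
    · obtain ⟨m, hm, hmax⟩ := hc.isCompact.exists_isGreatest hne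
      have hmT : m < T := hs hm
      refine ⟨(m + T) / 2, by linarith, fun x hx => image_eq_zero_of_notMem_tsupport fun h => ?_⟩
      linarith [hmax h]
  set g : ℝ → ℝ := fun x => leftCutoff x * rightInt b ψ x
  have hg : ContDiff ℝ (⊤ : ℕ∞) g :=
    (Real.smoothTransition.contDiff.comp (contDiff_id.add contDiff_const)).mul
      (contDiff_rightInt hb hψ hc)
  have hz : ∀ x, x ∉ Icc (-1) R → g x = 0 := by
    intro x hx
    rcases lt_or_ge x (-1) with h | h
    · simp only [g, leftCutoff]
      rw [Real.smoothTransition.zero_of_nonpos (by linarith), zero_mul]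
    · have : R ≤ x := by
        by_contra! h'
        exact hx ⟨h, h'.le⟩
      simp only [g]
      rw [rightInt_eq_zero hR this, mul_zero]
  have hts : tsupport g ⊆ Icc (-1) R :=
    closure_minimal (fun x hx => by by_contra h; exact hx (hz x h)) isClosed_Icc
  refine ⟨⟨g, hg, HasCompactSupport.intro isCompact_Icc hz,
    hts.trans fun x hx => lt_of_le_of_lt hx.2 hRT⟩, fun x hx => ?_⟩
  change leftCutoff x * rightInt b ψ x = _
  rw [leftCutoff, Real.smoothTransition.one_of_one_le (by linarith), one_mul]

/-- A continuous solution of the distributional equation satisfies the Volterra equation. -/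
theorem volterra_of_caputo_eq {γ T u₀ : ℝ} (hγ0 : 0 < γ) (hγ1 : γ < 1) (hT : 0 < T)
    {u F : ℝ → ℝ} (hu : ContinuousOn u (Icc 0 T)) (hF : ContinuousOn F (Icc 0 T))
    (h : ∀ φ : TestFunction (leftRay T) ℝ (⊤ : ℕ∞),
      caputo γ T u₀ u φ = ∫ t in Ioo 0 T, F t * φ t) :
    ∀ t ∈ Ioo 0 T, u t = u₀ + 1 / Real.Gamma γ * leftInt γ F t := by
  have hΓ := (Real.Gamma_pos_of_pos hγ0).ne'
  have hΓ' := (Real.Gamma_pos_of_pos (sub_pos.2 hγ1)).ne'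
  have hFi : IntegrableOn F (Ioo 0 T) := hF.integrableOn_Icc.mono_set Ioo_subset_Icc_self
  set z : ℝ → ℝ := fun t => Real.Gamma γ * (u t - u₀) - leftInt γ F t with hzdef
  have hlc := continuousOn_leftInt hγ0 hT.le hF
  have hz : ContinuousOn z (Icc 0 T) :=
    (continuousOn_const.mul (hu.sub continuousOn_const)).sub hlc
  -- The equation is tested against the fractional integral of order `γ` of an arbitrary `ψ`; then
  -- `g_{-γ}` returns a multiple of `ψ`, and `z` is orthogonal to `ψ`.
  have hae : ∀ᵐ x, x ∈ Ioo 0 T → z x = 0 := by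
    refine isOpen_Ioo.ae_eq_zero_of_integral_contDiff_smul_eq_zero
      ((hz.integrableOn_Icc.mono_set Ioo_subset_Icc_self).locallyIntegrableOn) ?_
    intro ψ hψ hc hs
    have hψ1 : ContDiff ℝ 1 ψ := hψ.of_le (by exact_mod_cast le_top)
    have hsT : tsupport ψ ⊆ Iio T := fun x hx => (hs hx).2
    obtain ⟨φ, hφ⟩ := exists_testFunction_rightInt hγ0 hψ hc hsT
    have hR : ∀ x, T ≤ x → deriv ψ x = 0 := fun x hx =>
      eq_zero_of_le_of_tsupport_subset ((tsupport_deriv_subset (𝕜 := ℝ)).trans hsT) hx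
    have hdφ : ∀ x, 0 < x → deriv φ x = rightInt γ (deriv ψ) x := by
      intro x hx
      rw [← deriv_rightInt hγ0 hψ1 hc]
      refine Filter.EventuallyEq.deriv_eq ?_
      filter_upwards [Ioi_mem_nhds hx] with y hy using hφ y (le_of_lt hy)
    have hg : ∀ s, 0 < s → gNeg γ (fun t => φ (t + s)) = Real.Gamma γ * ψ s := by
      intro s hs
      have : rightInt (1 - γ) (deriv φ) s = rightInt (1 - γ) (rightInt γ (deriv ψ)) s :=
        setIntegral_congr_fun measurableSet_Ioi fun x hx => by
          simp only [hdφ (s + x) (add_pos hs hx)]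
      rw [gNeg_comp_add, this, rightInt_rightInt_deriv (sub_pos.2 hγ1) hγ0 (by ring) hψ1 hc hR]
      field_simp
    have h1 : ∫ s in Ioo 0 T, (u s - u₀) * (Real.Gamma γ * ψ s) =
        ∫ x in Ioo 0 T, leftInt γ F x * ψ x := by
      rw [← integral_mul_rightInt hγ0 hFi hψ.continuous
        (fun x hx => eq_zero_of_le_of_tsupport_subset hsT hx)]
      calc _ = caputo γ T u₀ u φ :=
            setIntegral_congr_fun measurableSet_Ioo fun s hs => by simp only [hg s hs.1]
        _ = _ := by
            rw [h φ]
            exact setIntegral_congr_fun measurableSet_Ioo fun s hs => by simp only [hφ s hs.1.le]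
    have h2 : ∫ x, ψ x • z x = ∫ x in Ioo 0 T, ψ x * z x := by
      refine (setIntegral_eq_integral_of_forall_compl_eq_zero fun x hx => ?_).symm
      rw [image_eq_zero_of_notMem_tsupport fun hm => hx (hs hm), zero_smul]
    rw [h2]
    have h3 : ∫ x in Ioo 0 T, ψ x * z x = ∫ x in Ioo 0 T,
        ((u x - u₀) * (Real.Gamma γ * ψ x) - leftInt γ F x * ψ x) :=
      setIntegral_congr_fun measurableSet_Ioo fun x _ => by simp only [hzdef]; ring
    rw [h3, integral_sub, h1, sub_self]
    · exact (((hu.sub continuousOn_const).mul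
        (continuousOn_const.mul hψ.continuous.continuousOn)).integrableOn_Icc).mono_set
          Ioo_subset_Icc_self
    · exact ((hlc.mul hψ.continuous.continuousOn).integrableOn_Icc).mono_set Ioo_subset_Icc_self
  have hall : EqOn z 0 (Ioo 0 T) := by
    refine Measure.eqOn_Ioo_of_ae_eq volume ?_ (hz.mono Ioo_subset_Icc_self) continuousOn_const
    exact (ae_restrict_iff' measurableSet_Ioo).2 hae
  intro t ht
  have := hall ht
  simp only [hzdef, Pi.zero_apply] at this
  field_simp
  linarith

/-! ### Comparison and exponential estimates for left-sided integrals -/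

theorem integrableOn_sub_rpow_mul {a c t : ℝ} (ha : 0 < a) {F : ℝ → ℝ}
    (hF : ContinuousOn F (Icc c t)) :
    IntegrableOn (fun s => (t - s) ^ (a - 1) * F s) (Ioo c t) := by
  have h := integrableOn_sub_rpow ha c t
  rw [← integrableOn_Icc_iff_integrableOn_Ioo] at h
  exact (h.mul_continuousOn hF isCompact_Icc).mono_set Ioo_subset_Icc_self

theorem leftInt_of_nonpos {a t : ℝ} (ht : t ≤ 0) (F : ℝ → ℝ) : leftInt a F t = 0 := by
  simp [leftInt, Ioo_eq_empty_of_le ht]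

theorem leftInt_sub {a t : ℝ} (ha : 0 < a) {F G : ℝ → ℝ} (hF : ContinuousOn F (Icc 0 t))
    (hG : ContinuousOn G (Icc 0 t)) :
    leftInt a F t - leftInt a G t = leftInt a (fun s => F s - G s) t := by
  simp only [leftInt, mul_sub]
  exact (integral_sub (integrableOn_sub_rpow_mul ha hF) (integrableOn_sub_rpow_mul ha hG)).symm

theorem leftInt_const_mul (a c t : ℝ) (F : ℝ → ℝ) :
    leftInt a (fun s => c * F s) t = c * leftInt a F t := by
  simp only [leftInt, ← integral_const_mul]
  congr 1
  ext s
  ring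

theorem leftInt_const {a t : ℝ} (ha : 0 < a) (ht : 0 ≤ t) (c : ℝ) :
    leftInt a (fun _ => c) t = t ^ a / a * c := by
  rw [leftInt, integral_mul_const, integral_sub_rpow ha ht, sub_zero]

theorem leftInt_mono {a t : ℝ} (ha : 0 < a) {F G : ℝ → ℝ} (hF : ContinuousOn F (Icc 0 t))
    (hG : ContinuousOn G (Icc 0 t)) (h : ∀ s ∈ Ioo 0 t, F s ≤ G s) :
    leftInt a F t ≤ leftInt a G t :=
  setIntegral_mono_on (integrableOn_sub_rpow_mul ha hF) (integrableOn_sub_rpow_mul ha hG)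
    measurableSet_Ioo fun s hs =>
      mul_le_mul_of_nonneg_left (h s hs) (Real.rpow_nonneg (sub_nonneg.2 hs.2.le) _)

theorem abs_leftInt_le {a t : ℝ} (ha : 0 < a) {F G : ℝ → ℝ} (hF : ContinuousOn F (Icc 0 t))
    (hG : ContinuousOn G (Icc 0 t)) (h : ∀ s ∈ Ioo 0 t, |F s| ≤ G s) :
    |leftInt a F t| ≤ leftInt a G t := by
  refine abs_le.2 ⟨?_, leftInt_mono ha hF hG fun s hs => (abs_le.1 (h s hs)).2⟩
  have h1 := leftInt_mono ha (F := fun s => -1 * G s) (continuousOn_const.mul hG) hF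
    fun s hs => by linarith [(abs_le.1 (h s hs)).1]
  rw [leftInt_const_mul] at h1
  linarith

theorem leftInt_split {a c t : ℝ} (ha : 0 < a) {F : ℝ → ℝ} (hF : ContinuousOn F (Icc 0 t))
    (hc : 0 ≤ c) (hct : c ≤ t) :
    leftInt a F t = (∫ s in Ioo 0 c, (t - s) ^ (a - 1) * F s) +
      ∫ s in Ioo c t, (t - s) ^ (a - 1) * F s := by
  have hi := (intervalIntegrable_iff_integrableOn_Ioo_of_le (hc.trans hct)).2
    (integrableOn_sub_rpow_mul ha hF)
  rw [leftInt]
  simp only [← integral_Ioc_eq_integral_Ioo]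
  rw [← intervalIntegral.integral_of_le (hc.trans hct), ← intervalIntegral.integral_of_le hc,
    ← intervalIntegral.integral_of_le hct]
  refine (intervalIntegral.integral_add_adjacent_intervals (hi.mono_set ?_) (hi.mono_set ?_)).symm
  · rw [uIcc_of_le hc, uIcc_of_le (hc.trans hct)]
    exact Icc_subset_Icc_right hct
  · rw [uIcc_of_le hct, uIcc_of_le (hc.trans hct)]
    exact Icc_subset_Icc_left hc

/-- Substituting `x = t - s` factors out `exp (r * t)`; extending the remaining integral to the
half-line gives a Gamma integral. The factor `(1 / r)^a` is small for large `r`. -/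
theorem leftInt_exp_le {a r : ℝ} (ha : 0 < a) (hr : 0 < r) {t : ℝ} (ht : 0 ≤ t) :
    leftInt a (fun s => Real.exp (r * s)) t ≤ (1 / r) ^ a * Real.Gamma a * Real.exp (r * t) := by
  have hG := Real.integral_rpow_mul_exp_neg_mul_Ioi ha hr
  have hpos : 0 < (1 / r) ^ a * Real.Gamma a := by
    have := Real.Gamma_pos_of_pos ha
    positivity
  have hint : IntegrableOn (fun x : ℝ => x ^ (a - 1) * Real.exp (-(r * x))) (Ioi 0) := by
    by_contra h
    rw [integral_undef h] at hG
    exact hpos.ne hG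
  have h1 : leftInt a (fun s => Real.exp (r * s)) t =
      (∫ x in Ioo 0 t, x ^ (a - 1) * Real.exp (-(r * x))) * Real.exp (r * t) := by
    rw [leftInt, ← integral_Ioc_eq_integral_Ioo, ← integral_Ioc_eq_integral_Ioo,
      ← intervalIntegral.integral_of_le ht, ← intervalIntegral.integral_of_le ht]
    have h2 := intervalIntegral.integral_comp_sub_left (a := 0) (b := t)
      (fun x => x ^ (a - 1) * Real.exp (-(r * x))) t
    rw [sub_self, sub_zero] at h2
    rw [← h2, ← intervalIntegral.integral_mul_const]
    refine intervalIntegral.integral_congr fun s _ => ?_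
    rw [mul_assoc, ← Real.exp_add]
    congr 2
    ring
  rw [h1, ← hG]
  refine mul_le_mul_of_nonneg_right ?_ (Real.exp_pos _).le
  refine setIntegral_mono_set hint ?_ (Ioo_subset_Ioi_self.eventuallyLE)
  refine (ae_restrict_iff' measurableSet_Ioi).2 (Eventually.of_forall fun x hx => ?_)
  exact mul_nonneg (Real.rpow_nonneg (le_of_lt hx) _) (Real.exp_pos _).le

theorem abs_leftInt_sub_le_exp {a r M t : ℝ} (ha : 0 < a) (hr : 0 < r) (ht : 0 ≤ t) (hM : 0 ≤ M)
    {F G : ℝ → ℝ} (hF : ContinuousOn F (Icc 0 t)) (hG : ContinuousOn G (Icc 0 t))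
    (h : ∀ s ∈ Ioo 0 t, |F s - G s| ≤ M * Real.exp (r * s)) :
    |1 / Real.Gamma a * leftInt a F t - 1 / Real.Gamma a * leftInt a G t| ≤
      M * (1 / r) ^ a * Real.exp (r * t) := by
  have hΓ := Real.Gamma_pos_of_pos ha
  have h1 : |leftInt a (fun s => F s - G s) t| ≤ leftInt a (fun s => M * Real.exp (r * s)) t :=
    abs_leftInt_le ha (hF.sub hG) (by fun_prop) h
  rw [leftInt_const_mul] at h1
  rw [← mul_sub, leftInt_sub ha hF hG, abs_mul, abs_of_pos (one_div_pos.2 hΓ)]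
  have h2 := h1.trans (mul_le_mul_of_nonneg_left (leftInt_exp_le ha hr ht) hM)
  calc _ ≤ 1 / Real.Gamma a * (M * ((1 / r) ^ a * Real.Gamma a * Real.exp (r * t))) := by
        gcongr
    _ = _ := by field_simp

/-! ### Volterra equations with Lipschitz nonlinearity -/

theorem exists_rpow_inv_mul_le {a : ℝ} (ha : 0 < a) (K : NNReal) :
    ∃ r : ℝ, 0 < r ∧ K * (1 / r) ^ a ≤ 1 / 2 := by
  have hK : (0 : ℝ) < 2 * K + 1 := by positivity
  refine ⟨(2 * K + 1) ^ (1 / a), by positivity, ?_⟩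
  rw [Real.div_rpow zero_le_one (by positivity), Real.one_rpow, ← Real.rpow_mul hK.le,
    one_div_mul_cancel ha.ne', Real.rpow_one, mul_one_div, div_le_div_iff₀ hK two_pos]
  linarith

theorem volterra_unique {a u₀ T : ℝ} (ha : 0 < a) {f : ℝ → ℝ} {K : NNReal}
    (hf : LipschitzWith K f) {u v : ℝ → ℝ} (hu : ContinuousOn u (Icc 0 T))
    (hv : ContinuousOn v (Icc 0 T))
    (hue : ∀ t ∈ Icc 0 T, u t = u₀ + 1 / Real.Gamma a * leftInt a (fun s => f (u s)) t)
    (hve : ∀ t ∈ Icc 0 T, v t = u₀ + 1 / Real.Gamma a * leftInt a (fun s => f (v s)) t) :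
    ∀ t ∈ Icc 0 T, u t = v t := by
  intro t₀ ht₀
  obtain ⟨r, hr, hKr⟩ := exists_rpow_inv_mul_le ha K
  -- At a maximum of the weighted difference the exponential estimate gives `m ≤ m / 2`.
  obtain ⟨t, ht, hmax⟩ := isCompact_Icc.exists_isMaxOn ⟨t₀, ht₀⟩
    (f := fun t => |u t - v t| * Real.exp (-(r * t)))
    (((hu.sub hv).abs).mul (by fun_prop))
  set m := |u t - v t| * Real.exp (-(r * t)) with hm
  have hm0 : 0 ≤ m := by positivity
  have hle : ∀ s ∈ Icc 0 T, |u s - v s| ≤ m * Real.exp (r * s) := by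
    intro s hs
    have h1 : |u s - v s| * Real.exp (-(r * s)) ≤ m := hmax hs
    rwa [Real.exp_neg, ← div_eq_mul_inv, div_le_iff₀ (Real.exp_pos _)] at h1
  have hsub : Icc 0 t ⊆ Icc 0 T := Icc_subset_Icc_right ht.2
  have h2 := abs_leftInt_sub_le_exp ha hr ht.1 (mul_nonneg K.2 hm0)
    (hf.continuous.comp_continuousOn (hu.mono hsub))
    (hf.continuous.comp_continuousOn (hv.mono hsub)) (fun s hs => by
      have h3 := hf.dist_le_mul (u s) (v s)
      rw [Real.dist_eq, Real.dist_eq] at h3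
      refine h3.trans ?_
      rw [mul_assoc]
      exact mul_le_mul_of_nonneg_left (hle s (hsub ⟨hs.1.le, hs.2.le⟩)) K.2)
  have h4 : |u t - v t| ≤ 1 / 2 * m * Real.exp (r * t) := by
    rw [hue t ht, hve t ht, add_sub_add_left_eq_sub]
    refine h2.trans ?_
    refine mul_le_mul_of_nonneg_right ?_ (Real.exp_pos _).le
    calc _ = K * (1 / r) ^ a * m := by simp only [NNReal.val_eq_coe]; ring
      _ ≤ _ := mul_le_mul_of_nonneg_right hKr hm0
  have h5 : m ≤ 1 / 2 * m := by
    conv_lhs => rw [hm, Real.exp_neg, ← div_eq_mul_inv]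
    rwa [div_le_iff₀ (Real.exp_pos _)]
  have h6 : m = 0 := by linarith
  have h7 := hle t₀ ht₀
  rw [h6, zero_mul] at h7
  exact sub_eq_zero.1 (abs_nonpos_iff.1 h7)

open BoundedContinuousFunction in
/-- Global solvability of the Volterra equation with a bounded Lipschitz right-hand side, by the
contraction principle in an exponentially weighted space. -/
theorem exists_volterra {a : ℝ} (ha : 0 < a) (u₀ : ℝ) {f : ℝ → ℝ} {K : NNReal} {M : ℝ}
    (hf : LipschitzWith K f) (hM : ∀ x, |f x| ≤ M) :
    ∃ u : ℝ → ℝ, Continuous u ∧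
      ∀ t, u t = u₀ + 1 / Real.Gamma a * leftInt a (fun s => f (u s)) t := by
  obtain ⟨r, hr, hKr⟩ := exists_rpow_inv_mul_le ha K
  have hM0 : 0 ≤ M := (abs_nonneg _).trans (hM 0)
  -- The bounded unknown is `y t = exp (-(r * |t|)) * u t`; `P` below is the Volterra operator in
  -- terms of `y`.
  set G : (ℝ →ᵇ ℝ) → ℝ → ℝ := fun y s => f (Real.exp (r * |s|) * y s) with hG
  have hGc : ∀ y, Continuous (G y) := fun y => hf.continuous.comp (by fun_prop)
  set P : (ℝ →ᵇ ℝ) → ℝ → ℝ := fun y t =>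
    Real.exp (-(r * |t|)) * (u₀ + 1 / Real.Gamma a * leftInt a (G y) t) with hP
  have hPc : ∀ y, Continuous (P y) := fun y => by
    have := continuous_leftInt ha (hGc y) (fun x => hM _)
    exact (by fun_prop : Continuous fun t : ℝ => Real.exp (-(r * |t|))).mul
      (continuous_const.add (continuous_const.mul this))
  have hweight : ∀ t : ℝ, Real.exp (-(r * |t|)) ≤ 1 := fun t =>
    Real.exp_le_one_iff.2 (by have := abs_nonneg t; nlinarith)
  -- Used twice: with `H = 0` for boundedness of `P y`, and with two iterates for the contraction.
  have hdiff : ∀ (F H : ℝ → ℝ) (N : ℝ), Continuous F → Continuous H → 0 ≤ N →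
      (∀ s, |F s - H s| ≤ N * Real.exp (r * |s|)) → ∀ t,
      |1 / Real.Gamma a * leftInt a F t - 1 / Real.Gamma a * leftInt a H t| *
        Real.exp (-(r * |t|)) ≤ N * (1 / r) ^ a := by
    intro F H N hF hH hN h t
    rcases le_total t 0 with ht | ht
    · rw [leftInt_of_nonpos ht, leftInt_of_nonpos ht, sub_self, abs_zero, zero_mul]
      positivity
    · have h1 := abs_leftInt_sub_le_exp ha hr ht hN hF.continuousOn hH.continuousOn
        (fun s hs => by simpa only [abs_of_pos hs.1] using h s)
      rw [abs_of_nonneg ht, Real.exp_neg, ← div_eq_mul_inv, div_le_iff₀ (Real.exp_pos _)]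
      exact h1
  have hPb : ∀ y t, ‖P y t‖ ≤ |u₀| + M * (1 / r) ^ a := by
    intro y t
    have h1 := hdiff (G y) (fun _ => 0) M (hGc y) continuous_const hM0 (fun s => by
      rw [sub_zero]
      refine (hM _).trans (le_mul_of_one_le_right hM0 (Real.one_le_exp (by positivity)))) t
    have h0 : leftInt a (fun _ => (0 : ℝ)) t = 0 := by simp [leftInt]
    rw [h0, mul_zero, sub_zero] at h1
    simp only [hP, Real.norm_eq_abs, abs_mul (Real.exp _), abs_of_pos (Real.exp_pos _)]
    calc _ ≤ Real.exp (-(r * |t|)) * (|u₀| + |1 / Real.Gamma a * leftInt a (G y) t|) := by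
          gcongr
          exact abs_add_le _ _
      _ = Real.exp (-(r * |t|)) * |u₀| + |1 / Real.Gamma a * leftInt a (G y) t| *
            Real.exp (-(r * |t|)) := by ring
      _ ≤ 1 * |u₀| + M * (1 / r) ^ a := by
          gcongr
          exact hweight t
      _ = _ := by ring
  set Φ : (ℝ →ᵇ ℝ) → (ℝ →ᵇ ℝ) := fun y => ofNormedAddCommGroup (P y) (hPc y) _ (hPb y) with hΦ
  have hcontr : ContractingWith (1 / 2) Φ := by
    refine ⟨by rw [← NNReal.coe_lt_coe]; norm_num, LipschitzWith.of_dist_le_mul fun x y => ?_⟩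
    refine (BoundedContinuousFunction.dist_le (by positivity)).2 fun t => ?_
    have h1 := hdiff (G x) (G y) (K * dist x y) (hGc x) (hGc y) (by positivity) (fun s => by
      have h2 := hf.dist_le_mul (Real.exp (r * |s|) * x s) (Real.exp (r * |s|) * y s)
      rw [Real.dist_eq, Real.dist_eq, ← mul_sub, abs_mul, abs_of_pos (Real.exp_pos _)] at h2
      refine h2.trans ?_
      rw [mul_assoc, mul_comm (dist x y)]
      refine mul_le_mul_of_nonneg_left (mul_le_mul_of_nonneg_left ?_ (Real.exp_pos _).le) K.2
      exact BoundedContinuousFunction.dist_coe_le_dist (f := x) (g := y) s) t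
    change |P x t - P y t| ≤ _
    simp only [hP]
    rw [← mul_sub, add_sub_add_left_eq_sub, abs_mul, abs_of_pos (Real.exp_pos _), mul_comm]
    refine h1.trans ?_
    calc _ = K * (1 / r) ^ a * dist x y := by ring
      _ ≤ 1 / 2 * dist x y := mul_le_mul_of_nonneg_right hKr dist_nonneg
      _ = _ := by norm_num
  set y := hcontr.fixedPoint Φ
  have hy : Φ y = y := hcontr.fixedPoint_isFixedPt
  refine ⟨fun t => Real.exp (r * |t|) * y t, by fun_prop, fun t => ?_⟩
  have h1 : y t = P y t := by
    conv_lhs => rw [← hy]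
    rfl
  change Real.exp (r * |t|) * y t = u₀ + 1 / Real.Gamma a * leftInt a (G y) t
  rw [h1]
  simp only [hP]
  rw [← mul_assoc, ← Real.exp_add, add_neg_cancel, Real.exp_zero, one_mul]

/-! ### Positivity and strict decrease -/

theorem div_rpow_mul_rpow {a t t₁ x : ℝ} (ht : 0 < t) (ht₁ : 0 < t₁) (hx : 0 ≤ x) :
    (t / t₁) ^ (1 - a) * x ^ (a - 1) = (t₁ / t * x) ^ (a - 1) := by
  rw [Real.mul_rpow (by positivity) hx, ← inv_div t₁ t, Real.inv_rpow (by positivity),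
    ← Real.rpow_neg (by positivity), neg_sub]

/-- Propagation of positivity for Volterra equations with kernel `t^(a-1)` and a dissipative
term `k`; the kernel is used through its logarithmic convexity. -/
theorem volterra_pos_at_endpoint {a t₁ C : ℝ} (ha : 0 < a) (ha1 : a < 1) (ht₁ : 0 < t₁) (hC : 0 ≤ C)
    {q z k : ℝ → ℝ} (hzc : ContinuousOn z (Icc 0 t₁)) (hkc : ContinuousOn k (Icc 0 t₁))
    (hk : ∀ s ∈ Ico 0 t₁, 0 ≤ k s ∧ k s ≤ C * z s)
    (heq : ∀ t ∈ Icc 0 t₁, z t = q t - leftInt a k t)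
    (hq : ∀ t ∈ Ioo 0 t₁, (t / t₁) ^ (1 - a) * q t ≤ q t₁)
    (hz : ∀ t ∈ Ico 0 t₁, 0 < z t) : 0 < z t₁ := by
  -- With `δ < t₁ / 2`, every `t ≥ t₁ - δ` has `t / t₁ ≥ 1 / 2`. The aim is `z t₁ ≥ ((t / t₁)^(1-a)
  -- - C δ^a / a) * z t`, with positive coefficient, where `t` maximises `z` on `[t₁ - δ, t₁]`.
  obtain ⟨δ, hδC, hδ⟩ : ∃ δ : ℝ, C * (δ ^ a / a) < (1 / 2) ^ (1 - a) ∧ δ ∈ Ioo 0 (t₁ / 2) := by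
    have h1 : Tendsto (fun δ : ℝ => C * (δ ^ a / a)) (𝓝[>] 0) (𝓝 0) := by
      have h2 : ContinuousAt (fun δ : ℝ => C * (δ ^ a / a)) 0 :=
        continuousAt_const.mul ((Real.continuousAt_rpow_const 0 a (Or.inr ha.le)).div_const a)
      have h3 := h2.tendsto
      rw [Real.zero_rpow ha.ne', zero_div, mul_zero] at h3
      exact h3.mono_left nhdsWithin_le_nhds
    have h4 : (0 : ℝ) < (1 / 2) ^ (1 - a) := by positivity
    exact ((h1.eventually (gt_mem_nhds h4)).and (Ioo_mem_nhdsGT (half_pos ht₁))).exists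
  obtain ⟨hδ0, hδ1⟩ := hδ
  obtain ⟨t, ht, hmax⟩ := (isCompact_Icc (a := t₁ - δ) (b := t₁)).exists_isMaxOn
    ⟨t₁, by linarith, le_rfl⟩ (hzc.mono (Icc_subset_Icc_left (by linarith)))
  have hzt : 0 < z t := (hz (t₁ - δ) ⟨by linarith, by linarith⟩).trans_le
    (hmax ⟨le_rfl, by linarith⟩)
  rcases ht.2.eq_or_lt with rfl | htt
  · exact hzt
  have ht0 : 0 < t := by linarith [ht.1]
  have hsub : Icc 0 t ⊆ Icc 0 t₁ := Icc_subset_Icc_right ht.2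
  -- Old memory: `(t₁ / t) * (t - s) ≤ t₁ - s` and the exponent `a - 1` is negative, so the kernel
  -- at `t₁` lies below the rescaled kernel at `t`.
  have hA : ∫ s in Ioo 0 t, (t₁ - s) ^ (a - 1) * k s ≤ (t / t₁) ^ (1 - a) * leftInt a k t := by
    rw [leftInt, ← integral_const_mul]
    have hi1 : IntegrableOn (fun s => (t₁ - s) ^ (a - 1) * k s) (Ioo 0 t) :=
      (integrableOn_sub_rpow_mul ha hkc).mono_set (Ioo_subset_Ioo_right ht.2)
    refine setIntegral_mono_on hi1
      ((integrableOn_sub_rpow_mul ha (hkc.mono hsub)).const_mul _) measurableSet_Ioo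
      fun s hs => ?_
    rw [← mul_assoc]
    refine mul_le_mul_of_nonneg_right ?_ (hk s ⟨hs.1.le, hs.2.trans htt⟩).1
    rw [div_rpow_mul_rpow ht0 ht₁ (by linarith [hs.2])]
    refine Real.rpow_le_rpow_of_nonpos (mul_pos (by positivity) (by linarith [hs.2])) ?_
      (by linarith)
    have h1 : 1 ≤ t₁ / t := (one_le_div ht0).2 ht.2
    have h2 : t₁ / t * (t - s) = t₁ - t₁ / t * s := by field_simp
    rw [h2]
    nlinarith [hs.1]
  -- Recent memory: here `k ≤ C * z ≤ C * z t` by maximality of `z t`.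
  have hB : ∫ s in Ioo t t₁, (t₁ - s) ^ (a - 1) * k s ≤ C * (δ ^ a / a) * z t := by
    have h1 : ∫ s in Ioo t t₁, (t₁ - s) ^ (a - 1) * k s ≤
        ∫ s in Ioo t t₁, (t₁ - s) ^ (a - 1) * (C * z t) := by
      refine setIntegral_mono_on
        (integrableOn_sub_rpow_mul ha (hkc.mono (Icc_subset_Icc_left ht0.le)))
        (integrableOn_sub_rpow_mul ha continuousOn_const) measurableSet_Ioo fun s hs => ?_
      refine mul_le_mul_of_nonneg_left ?_ (Real.rpow_nonneg (by linarith [hs.2]) _)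
      refine (hk s ⟨by linarith [hs.1], hs.2⟩).2.trans (mul_le_mul_of_nonneg_left ?_ hC)
      exact hmax ⟨by linarith [hs.1, ht.1], hs.2.le⟩
    rw [integral_mul_const, integral_sub_rpow ha ht.2] at h1
    refine h1.trans ?_
    have h2 : (t₁ - t) ^ a ≤ δ ^ a := Real.rpow_le_rpow (by linarith) (by linarith [ht.1]) ha.le
    calc (t₁ - t) ^ a / a * (C * z t) ≤ δ ^ a / a * (C * z t) := by gcongr
      _ = _ := by ring
  have hsplit := leftInt_split ha hkc ht0.le ht.2
  have h1 := heq t₁ ⟨ht₁.le, le_rfl⟩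
  have h2 := heq t ⟨ht0.le, ht.2⟩
  have h3 := hq t ⟨ht0, htt⟩
  have h4 : (1 / 2 : ℝ) ^ (1 - a) ≤ (t / t₁) ^ (1 - a) := by
    refine Real.rpow_le_rpow (by norm_num) ?_ (by linarith)
    rw [div_le_div_iff₀ two_pos ht₁]
    linarith [ht.1]
  have h5 : leftInt a k t = q t - z t := by linarith
  rw [h5, mul_sub] at hA
  have h6 : 0 < ((t / t₁) ^ (1 - a) - C * (δ ^ a / a)) * z t := mul_pos (by linarith) hzt
  linarith [h6, sub_mul ((t / t₁) ^ (1 - a)) (C * (δ ^ a / a)) (z t)]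

theorem forall_pos_of_first_zero {z : ℝ → ℝ} (hz : ContinuousOn z (Ici 0)) (h0 : 0 < z 0)
    (h : ∀ t, 0 < t → (∀ s ∈ Ico 0 t, 0 < z s) → 0 < z t) : ∀ t, 0 ≤ t → 0 < z t := by
  by_contra! hcon
  set S : Set ℝ := Ici 0 ∩ z ⁻¹' Iic 0
  have hS : IsClosed S := hz.preimage_isClosed_of_isClosed isClosed_Ici isClosed_Iic
  have hne : S.Nonempty := hcon
  have hbdd : BddBelow S := ⟨0, fun x hx => hx.1⟩
  have hm : sInf S ∈ S := hS.csInf_mem hne hbdd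
  have hpos : 0 < sInf S := by
    refine lt_of_le_of_ne hm.1 fun he => ?_
    have : z (sInf S) ≤ 0 := hm.2
    rw [← he] at this
    linarith
  have := h _ hpos fun s hs => by
    by_contra! hle
    exact (csInf_le hbdd ⟨hs.1, hle⟩).not_gt hs.2
  exact this.not_ge hm.2

theorem volterra_strictAntiOn {a u₀ : ℝ} (ha : 0 < a) (ha1 : a < 1) {f : ℝ → ℝ} {K : NNReal}
    (hf : LipschitzWith K f) (hneg : ∀ x, f x < 0) (hmono : Monotone f ∨ Antitone f)
    {u : ℝ → ℝ} (hu : Continuous u)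
    (hue : ∀ t, u t = u₀ + 1 / Real.Gamma a * leftInt a (fun s => f (u s)) t) :
    StrictAntiOn u (Ici 0) := by
  have hΓ := one_div_pos.2 (Real.Gamma_pos_of_pos ha)
  suffices H : ∀ h, 0 < h → ∀ t, 0 ≤ t → 0 < u t - u (t + h) by
    intro x hx y _ hxy
    have := H (y - x) (sub_pos.2 hxy) x hx
    rw [add_sub_cancel] at this
    linarith
  intro h hh
  have hFc : Continuous fun s => f (u s) := hf.continuous.comp hu
  have hGc : Continuous fun s => f (u (s + h)) := hFc.comp (continuous_id.add continuous_const)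
  -- The contribution of the initial stretch `(0, h)` to `u (t + h)`, with the sign that makes it
  -- positive forcing for `u t - u (t + h)`.
  set q : ℝ → ℝ := fun t =>
    1 / Real.Gamma a * ∫ s in Ioo 0 h, (t + h - s) ^ (a - 1) * -f (u s)
  have hqi : ∀ t, 0 ≤ t → IntegrableOn (fun s => (t + h - s) ^ (a - 1) * -f (u s)) (Ioo 0 h) :=
    fun t ht => (integrableOn_sub_rpow_mul ha hFc.neg.continuousOn).mono_set
      (Ioo_subset_Ioo_right (by linarith))
  have hqpos : ∀ t, 0 ≤ t → 0 < q t := by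
    intro t ht
    refine mul_pos hΓ ?_
    rw [← integral_Ioc_eq_integral_Ioo, ← intervalIntegral.integral_of_le hh.le]
    refine intervalIntegral.intervalIntegral_pos_of_pos_on
      ((intervalIntegrable_iff_integrableOn_Ioo_of_le hh.le).2 (hqi t ht)) (fun s hs => ?_) hh
    exact mul_pos (Real.rpow_pos_of_pos (by linarith [hs.2]) _) (neg_pos.2 (hneg _))
  have hdiff : ∀ t, 0 ≤ t → u t - u (t + h) = q t -
      leftInt a (fun s => 1 / Real.Gamma a * (f (u (s + h)) - f (u s))) t := by
    intro t ht
    have h1 := leftInt_split (t := t + h) ha hFc.continuousOn hh.le (by linarith)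
    have h2 : ∫ s in Ioo h (t + h), (t + h - s) ^ (a - 1) * f (u s) =
        leftInt a (fun s => f (u (s + h))) t := by
      rw [leftInt, ← integral_Ioc_eq_integral_Ioo, ← integral_Ioc_eq_integral_Ioo,
        ← intervalIntegral.integral_of_le (by linarith), ← intervalIntegral.integral_of_le ht]
      have h3 := intervalIntegral.integral_comp_add_right (a := 0) (b := t)
        (fun s => (t + h - s) ^ (a - 1) * f (u s)) h
      rw [zero_add] at h3
      rw [← h3]
      simp only [add_sub_add_right_eq_sub]
    rw [leftInt_const_mul, ← leftInt_sub ha hGc.continuousOn hFc.continuousOn, hue t, hue (t + h),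
      h1, h2]
    simp only [q, mul_neg, integral_neg]
    ring
  have hzc : Continuous fun t => u t - u (t + h) :=
    hu.sub (hu.comp (continuous_id.add continuous_const))
  have hkc : Continuous fun s => 1 / Real.Gamma a * (f (u (s + h)) - f (u s)) :=
    continuous_const.mul (hGc.sub hFc)
  refine forall_pos_of_first_zero hzc.continuousOn ?_ fun t₁ ht₁ hz => ?_
  · rw [hdiff 0 le_rfl, leftInt_of_nonpos le_rfl, sub_zero]
    exact hqpos 0 le_rfl
  -- For monotone `f` the memory integrand is nonpositive before `t₁`, so the difference is at least
  -- `q t₁ > 0`. For antitone `f` it lies between `0` and a multiple of the difference, as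
  -- `volterra_pos_at_endpoint` requires.
  rcases hmono with hmono | hanti
  · rw [hdiff t₁ ht₁.le]
    have h1 := leftInt_mono ha hkc.continuousOn continuousOn_const (G := fun _ => (0 : ℝ))
      (t := t₁) fun s hs => by
        have h2 := hz s ⟨hs.1.le, hs.2⟩
        have h3 : f (u (s + h)) ≤ f (u s) := hmono (by linarith)
        exact mul_nonpos_of_nonneg_of_nonpos hΓ.le (by linarith)
    rw [leftInt_const ha ht₁.le, mul_zero] at h1
    linarith [hqpos t₁ ht₁.le]
  · refine volterra_pos_at_endpoint ha ha1 ht₁ (C := 1 / Real.Gamma a * K)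
      (mul_nonneg hΓ.le K.2) hzc.continuousOn hkc.continuousOn (fun s hs => ?_)
      (fun t ht => hdiff t ht.1) (fun t ht => ?_) hz
    · have h2 := hz s hs
      have h3 : f (u s) ≤ f (u (s + h)) := hanti (by linarith)
      refine ⟨mul_nonneg hΓ.le (by linarith), ?_⟩
      rw [mul_assoc]
      refine mul_le_mul_of_nonneg_left ?_ hΓ.le
      have h4 := hf.dist_le_mul (u s) (u (s + h))
      rw [Real.dist_eq, Real.dist_eq, abs_of_pos h2] at h4
      linarith [neg_abs_le (f (u s) - f (u (s + h)))]
    · simp only [q]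
      rw [mul_left_comm]
      refine mul_le_mul_of_nonneg_left ?_ hΓ.le
      rw [← integral_const_mul]
      refine setIntegral_mono_on ((hqi t ht.1.le).const_mul _) (hqi t₁ ht₁.le) measurableSet_Ioo
        fun s hs => ?_
      rw [← mul_assoc]
      refine mul_le_mul_of_nonneg_right ?_ (neg_pos.2 (hneg _)).le
      rw [div_rpow_mul_rpow ht.1 ht₁ (by linarith [hs.2, ht.1])]
      refine Real.rpow_le_rpow_of_nonpos (by linarith [hs.2]) ?_ (by linarith)
      have h1 : 1 ≤ t₁ / t := (one_le_div ht.1).2 ht.2.le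
      have h2 : t₁ / t * (t + h - s) = t₁ + t₁ / t * (h - s) := by
        have := ht.1.ne'
        field_simp
        ring
      rw [h2]
      nlinarith [hs.2]

/-- The bound `f ≤ -c` forces `u` below `u₀` minus a positive multiple of `t^a`, which tends to
`-∞`; the intermediate value theorem does the rest. -/
theorem exists_hitting_time {a u₀ c ε : ℝ} (ha : 0 < a) (hc : 0 < c) {f : ℝ → ℝ}
    (hf : Continuous f) (hfc : ∀ x, f x ≤ -c) (hε : ε < u₀) {u : ℝ → ℝ} (hu : Continuous u)
    (hue : ∀ t, u t = u₀ + 1 / Real.Gamma a * leftInt a (fun s => f (u s)) t) :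
    ∃ T, 0 < T ∧ u T = ε := by
  have hΓ := one_div_pos.2 (Real.Gamma_pos_of_pos ha)
  have hu0 : u 0 = u₀ := by rw [hue 0, leftInt_of_nonpos le_rfl, mul_zero, add_zero]
  have hle : ∀ t, 0 ≤ t → u t ≤ u₀ - 1 / Real.Gamma a * (t ^ a / a * c) := by
    intro t ht
    have h1 := leftInt_mono ha (t := t) (hf.comp hu).continuousOn continuousOn_const
      (G := fun _ => -c) fun s _ => hfc _
    rw [leftInt_const ha ht] at h1
    have h2 := mul_le_mul_of_nonneg_left h1 hΓ.le
    rw [hue t]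
    simp only [Function.comp_def] at h2
    linarith
  have htend : Tendsto (fun t : ℝ => 1 / Real.Gamma a * (t ^ a / a * c)) atTop atTop :=
    (((tendsto_rpow_atTop ha).atTop_div_const ha).atTop_mul_const hc).const_mul_atTop hΓ
  obtain ⟨t, ht, ht0⟩ := ((htend.eventually_ge_atTop (u₀ - ε)).and (eventually_ge_atTop 0)).exists
  obtain ⟨T, hT, hTe⟩ := intermediate_value_Icc' ht0 hu.continuousOn
    (show ε ∈ Icc (u t) (u 0) from ⟨by linarith [hle t ht0], by rw [hu0]; exact hε.le⟩)
  refine ⟨T, lt_of_le_of_ne hT.1 fun he => ?_, hTe⟩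
  rw [← he, hu0] at hTe
  linarith

/-! ### The clamped equation and its comparison with the original one -/

/-- The power nonlinearity with its argument clamped to `[ε, R]`. -/
def clampedPower (A p ε R x : ℝ) : ℝ := A * (max ε (min x R)) ^ p

theorem clampedPower_of_mem {A p ε R x : ℝ} (hx : x ∈ Icc ε R) :
    clampedPower A p ε R x = A * x ^ p := by
  rw [clampedPower, min_eq_left hx.2, max_eq_right hx.1]

theorem clampedPower_mem {ε R : ℝ} (h : ε ≤ R) (x : ℝ) : max ε (min x R) ∈ Icc ε R :=
  ⟨le_max_left _ _, max_le h (min_le_right _ _)⟩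

theorem continuousOn_const_mul_rpow {A p : ℝ} : ContinuousOn (fun x : ℝ => A * x ^ p) (Ioi 0) :=
  continuousOn_const.mul (continuousOn_id.rpow_const fun _ hx => Or.inl (ne_of_gt hx))

theorem clampedPower_lipschitz (A p : ℝ) {ε R : ℝ} (hε : 0 < ε) (h : ε ≤ R) :
    ∃ K, LipschitzWith K (clampedPower A p ε R) := by
  have h1 : ContDiffOn ℝ 1 (fun x : ℝ => A * x ^ p) (Icc ε R) := by
    refine contDiffOn_const.mul (contDiffOn_id.rpow_const_of_ne fun x hx => ?_)
    exact (hε.trans_le hx.1).ne'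
  obtain ⟨K, hK⟩ := h1.exists_lipschitzOnWith one_ne_zero (convex_Icc _ _) isCompact_Icc
  have h2 : LipschitzWith 1 fun x : ℝ => max ε (min x R) :=
    (LipschitzWith.id.min_const R).const_max ε
  refine ⟨K * 1, LipschitzWith.of_dist_le_mul fun x y => ?_⟩
  refine (hK.dist_le_mul _ (clampedPower_mem h x) _ (clampedPower_mem h y)).trans ?_
  rw [NNReal.coe_mul, mul_assoc]
  exact mul_le_mul_of_nonneg_left (h2.dist_le_mul x y) K.2

theorem clampedPower_le {A p ε R : ℝ} (hA : A < 0) (hε : 0 < ε) (h : ε ≤ R) :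
    ∃ c, 0 < c ∧ ∀ x, clampedPower A p ε R x ≤ -c := by
  obtain ⟨y, hy, hmax⟩ := isCompact_Icc.exists_isMaxOn (nonempty_Icc.2 h)
    ((continuousOn_const_mul_rpow (A := A) (p := p)).mono fun x hx => hε.trans_le hx.1)
  refine ⟨-(A * y ^ p), ?_, fun x => ?_⟩
  · have := mul_neg_of_neg_of_pos hA (Real.rpow_pos_of_pos (hε.trans_le hy.1) p)
    linarith
  · rw [neg_neg]
    exact hmax (clampedPower_mem h x)

theorem clampedPower_bounded (A p : ℝ) {ε R : ℝ} (hε : 0 < ε) (h : ε ≤ R) :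
    ∃ M, ∀ x, |clampedPower A p ε R x| ≤ M := by
  obtain ⟨M, hM⟩ := (isCompact_Icc (a := ε) (b := R)).exists_bound_of_continuousOn
    ((continuousOn_const_mul_rpow (A := A) (p := p)).mono fun x hx => hε.trans_le hx.1)
  exact ⟨M, fun x => hM _ (clampedPower_mem h x)⟩

theorem clampedPower_monotone_or_antitone {A p ε R : ℝ} (hA : A < 0) (hε : 0 < ε) :
    Monotone (clampedPower A p ε R) ∨ Antitone (clampedPower A p ε R) := by
  have hcl : ∀ x y : ℝ, x ≤ y → max ε (min x R) ≤ max ε (min y R) := fun x y hxy =>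
    max_le_max_left _ (min_le_min_right _ hxy)
  rcases le_total 0 p with hp | hp
  · right
    intro x y hxy
    refine mul_le_mul_of_nonpos_left ?_ hA.le
    exact Real.rpow_le_rpow (hε.le.trans (le_max_left _ _)) (hcl x y hxy) hp
  · left
    intro x y hxy
    refine mul_le_mul_of_nonpos_left ?_ hA.le
    exact Real.rpow_le_rpow_of_nonpos (hε.trans_le (le_max_left _ _)) (hcl x y hxy) hp

theorem exists_clamped_solution {γ A p u₀ ε : ℝ} (hγ0 : 0 < γ) (hγ1 : γ < 1) (hA : A < 0)
    (hε : 0 < ε) (h : ε < u₀) :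
    ∃ (U : ℝ → ℝ) (T : ℝ), Continuous U ∧ StrictAntiOn U (Ici 0) ∧ U 0 = u₀ ∧ 0 < T ∧ U T = ε ∧
      ∀ t, U t = u₀ + 1 / Real.Gamma γ *
        leftInt γ (fun s => clampedPower A p ε u₀ (U s)) t := by
  obtain ⟨K, hK⟩ := clampedPower_lipschitz A p hε h.le
  obtain ⟨M, hM⟩ := clampedPower_bounded A p hε h.le
  obtain ⟨c, hc, hfc⟩ := clampedPower_le (p := p) hA hε h.le
  obtain ⟨U, hU, hUe⟩ := exists_volterra hγ0 u₀ hK hM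
  obtain ⟨T, hT, hTe⟩ := exists_hitting_time hγ0 hc hK.continuous hfc h hU hUe
  refine ⟨U, T, hU, ?_, ?_, hT, hTe, hUe⟩
  · exact volterra_strictAntiOn hγ0 hγ1 hK (fun x => by linarith [hfc x])
      (clampedPower_monotone_or_antitone hA hε) hU hUe
  · rw [hUe 0, leftInt_of_nonpos le_rfl, mul_zero, add_zero]

theorem continuousOn_power_comp {A p : ℝ} {v : ℝ → ℝ} {s : Set ℝ} (hv : ContinuousOn v s)
    (hpos : ∀ t ∈ s, 0 < v t) : ContinuousOn (fun t => A * v t ^ p) s :=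
  continuousOn_const_mul_rpow.comp hv hpos

/-- A positive continuous strong solution satisfies the Volterra equation. -/
theorem IsContinuousStrongSolution.volterra {γ A p u₀ : ℝ} (hγ0 : 0 < γ) (hγ1 : γ < 1) {b : EReal}
    {v : ℝ → ℝ}
    (hv : IsContinuousStrongSolution γ (fun x : ℝ => A * x ^ p) (Ioi 0) u₀ b v) {t : ℝ}
    (ht : 0 ≤ t) (htb : (t : EReal) < b) :
    v t = u₀ + 1 / Real.Gamma γ * leftInt γ (fun s => A * v s ^ p) t := by
  rcases ht.eq_or_lt with rfl | ht0
  · rw [hv.initial, leftInt_of_nonpos le_rfl, mul_zero, add_zero]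
  obtain ⟨S, htS, hSb⟩ := EReal.lt_iff_exists_real_btwn.1 htb
  have htS' : t < S := EReal.coe_lt_coe_iff.1 htS
  have hsub : Icc 0 S ⊆ {t : ℝ | 0 ≤ t ∧ (t : EReal) < b} := fun x hx =>
    ⟨hx.1, (EReal.coe_le_coe_iff.2 hx.2).trans_lt hSb⟩
  have hc := hv.continuousOn.mono hsub
  exact volterra_of_caputo_eq hγ0 hγ1 (ht0.trans htS') hc
    (continuousOn_power_comp hc fun x hx => hv.mem_domain x (hsub hx).1 (hsub hx).2)
    (hv.strong S (ht0.trans htS') hSb).equation t ⟨ht0, htS'⟩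

/-- The integrand is nonpositive because `A < 0`. This is why clamping from above at `u₀` loses no
positive solution. -/
theorem volterra_le_initial {γ A p u₀ t : ℝ} (hγ0 : 0 < γ) (hA : A < 0) {v : ℝ → ℝ}
    (hpos : ∀ s ∈ Icc 0 t, 0 < v s)
    (hve : v t = u₀ + 1 / Real.Gamma γ * leftInt γ (fun s => A * v s ^ p) t) : v t ≤ u₀ := by
  have h1 : leftInt γ (fun s => A * v s ^ p) t ≤ 0 :=
    setIntegral_nonpos measurableSet_Ioo fun s hs =>
      mul_nonpos_of_nonneg_of_nonpos (Real.rpow_nonneg (sub_nonneg.2 hs.2.le) _)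
        (mul_nonpos_of_nonpos_of_nonneg hA.le
          (Real.rpow_nonneg (hpos s ⟨hs.1.le, hs.2.le⟩).le _))
  have h2 := one_div_pos.2 (Real.Gamma_pos_of_pos hγ0)
  rw [hve]
  linarith [mul_nonpos_of_nonneg_of_nonpos h2.le h1]

/-- A solution that stays in `[ε, u₀]` coincides with the solution of the clamped equation. -/
theorem eq_clamped_solution {γ A p u₀ ε S : ℝ} (hγ0 : 0 < γ) (hε : 0 < ε) (h : ε ≤ u₀)
    {v U : ℝ → ℝ} (hv : ContinuousOn v (Icc 0 S)) (hU : Continuous U)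
    (hmem : ∀ t ∈ Icc 0 S, v t ∈ Icc ε u₀)
    (hve : ∀ t ∈ Icc 0 S, v t = u₀ + 1 / Real.Gamma γ * leftInt γ (fun s => A * v s ^ p) t)
    (hUe : ∀ t, U t = u₀ + 1 / Real.Gamma γ *
        leftInt γ (fun s => clampedPower A p ε u₀ (U s)) t) :
    ∀ t ∈ Icc 0 S, v t = U t := by
  obtain ⟨K, hK⟩ := clampedPower_lipschitz A p hε h
  refine volterra_unique hγ0 hK hv hU.continuousOn (fun t ht => ?_) fun t _ => hUe t
  rw [hve t ht]
  congr 2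
  exact leftInt_congr fun s hs =>
    (clampedPower_of_mem (hmem s ⟨hs.1.le, hs.2.le.trans ht.2⟩)).symm

end FracODE

end

/-! ### Gluing the clamped solutions -/

theorem proposition5p5 (γ : ℝ) (hγ0 : 0 < γ) (hγ1 : γ < 1) (A : ℝ) (hA : A < 0)
    (u₀ : ℝ) (hu₀ : 0 < u₀) (p : ℝ) :
    ∃ (Tb : EReal) (u : ℝ → ℝ), 0 < Tb ∧
      -- existence on `[0, Tb)`
      FracODE.IsContinuousStrongSolution γ (fun x : ℝ => A * x ^ p) (Set.Ioi 0) u₀ Tb u ∧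
      -- maximality of `Tb` and uniqueness
      (∀ (b : EReal) (v : ℝ → ℝ), 0 < b →
        FracODE.IsContinuousStrongSolution γ (fun x : ℝ => A * x ^ p) (Set.Ioi 0) u₀ b v →
          b ≤ Tb ∧ ∀ t : ℝ, 0 ≤ t → (t : EReal) < b → v t = u t) ∧
      -- bounds, strict monotonicity and limit
      (∀ t : ℝ, 0 < t → (t : EReal) < Tb → 0 < u t ∧ u t < u₀) ∧
      StrictAntiOn u {t : ℝ | 0 < t ∧ (t : EReal) < Tb} ∧
      Filter.Tendsto u (Filter.comap (fun t : ℝ => (t : EReal)) (nhdsWithin Tb (Set.Iio Tb)))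
        (nhds 0) := by
  classical
  -- The shift by `2` keeps every level strictly below `u₀`, including the one for `n = 0`.
  set ε : ℕ → ℝ := fun n => u₀ / (n + 2) with hεdef
  have hε : ∀ n, 0 < ε n := fun n => by positivity
  have hεu : ∀ n, ε n < u₀ := fun n => div_lt_self hu₀ (by
    have : (0 : ℝ) ≤ n := n.cast_nonneg
    linarith)
  have hεanti : StrictAnti ε := fun m n hmn =>
    div_lt_div_of_pos_left hu₀ (by positivity) (by
      have : (m : ℝ) < n := Nat.cast_lt.2 hmn
      linarith)
  have hε0 : Tendsto ε atTop (𝓝 0) := by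
    refine Tendsto.const_div_atTop ?_ u₀
    exact tendsto_atTop_add_const_right _ _ tendsto_natCast_atTop_atTop
  choose U T hU hUa hU0 hT hUT hUe using fun n =>
    FracODE.exists_clamped_solution (p := p) hγ0 hγ1 hA (hε n) (hεu n)
  have hUmem : ∀ n, ∀ t ∈ Icc 0 (T n), U n t ∈ Icc (ε n) u₀ := by
    intro n t ht
    constructor
    · rw [← hUT n]
      exact (hUa n).antitoneOn ht.1 (hT n).le ht.2
    · rw [← hU0 n]
      exact (hUa n).antitoneOn (le_refl (0 : ℝ)) ht.1 ht.1
  have hUv : ∀ n, ∀ t ∈ Icc 0 (T n), U n t = u₀ + 1 / Real.Gamma γ *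
      FracODE.leftInt γ (fun s => A * U n s ^ p) t := by
    intro n t ht
    conv_lhs => rw [hUe n t]
    congr 2
    exact FracODE.leftInt_congr fun s hs =>
      FracODE.clampedPower_of_mem (hUmem n s ⟨hs.1.le, hs.2.le.trans ht.2⟩)
  -- A solution staying above `ε n` on `[0, S]` is `U n` there; as `U n` drops strictly below `ε n`
  -- after `T n`, this also forces `S ≤ T n`.
  have hcomp : ∀ (n : ℕ) (v : ℝ → ℝ) (S : ℝ), 0 ≤ S → ContinuousOn v (Icc 0 S) →
      (∀ t ∈ Icc 0 S, v t ∈ Icc (ε n) u₀) →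
      (∀ t ∈ Icc 0 S, v t = u₀ + 1 / Real.Gamma γ *
        FracODE.leftInt γ (fun s => A * v s ^ p) t) →
      S ≤ T n ∧ ∀ t ∈ Icc 0 S, v t = U n t := by
    intro n v S hS hv hmem hve
    have h1 := FracODE.eq_clamped_solution hγ0 (hε n) (hεu n).le hv (hU n) hmem hve (hUe n)
    refine ⟨?_, h1⟩
    by_contra! hlt
    have h2 := hUa n (hT n).le hS hlt
    rw [hUT n, ← h1 S ⟨hS, le_rfl⟩] at h2
    exact (hmem S ⟨hS, le_rfl⟩).1.not_gt h2
  have hmn : ∀ m n, m ≤ n → T m ≤ T n ∧ ∀ t ∈ Icc 0 (T m), U m t = U n t := fun m n h =>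
    hcomp n (U m) (T m) (hT m).le (hU m).continuousOn
      (fun t ht => ⟨(hεanti.antitone h).trans (hUmem m t ht).1, (hUmem m t ht).2⟩) (hUv m)
  have hTmono : StrictMono T := by
    intro m n h
    refine lt_of_le_of_ne (hmn m n h.le).1 fun he => ?_
    have h1 := (hmn m n h.le).2 (T m) ⟨(hT m).le, le_rfl⟩
    rw [hUT m, he, hUT n] at h1
    exact (hεanti h).ne' h1
  set Tb : EReal := ⨆ n, (T n : EReal) with hTb
  have hTlt : ∀ n, (T n : EReal) < Tb := fun n =>
    (EReal.coe_lt_coe_iff.2 (hTmono n.lt_succ_self)).trans_le (le_iSup (fun n => (T n : EReal)) _)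
  have hex : ∀ t : ℝ, (t : EReal) < Tb → ∃ n, t < T n := fun t ht => by
    obtain ⟨n, hn⟩ := lt_iSup_iff.1 ht
    exact ⟨n, EReal.coe_lt_coe_iff.1 hn⟩
  -- The choice of index is immaterial by `hmn`; the default `0` is taken only at times `t ≥ Tb`.
  set u : ℝ → ℝ := fun t => if h : ∃ n, t ≤ T n then U (Nat.find h) t else 0 with hu
  have huU : ∀ n, ∀ t ∈ Icc 0 (T n), u t = U n t := by
    intro n t ht
    have h : ∃ n, t ≤ T n := ⟨n, ht.2⟩
    simp only [hu, dif_pos h]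
    exact (hmn _ n (Nat.find_min' h ht.2)).2 t ⟨ht.1, Nat.find_spec h⟩
  have hupos : ∀ t : ℝ, 0 ≤ t → (t : EReal) < Tb → 0 < u t := by
    intro t ht htb
    obtain ⟨n, hn⟩ := hex t htb
    rw [huU n t ⟨ht, hn.le⟩]
    exact (hε n).trans_le (hUmem n t ⟨ht, hn.le⟩).1
  have hanti : StrictAntiOn u {t : ℝ | 0 ≤ t ∧ (t : EReal) < Tb} := by
    intro x hx y hy hxy
    obtain ⟨n, hn⟩ := hex y hy.2
    rw [huU n x ⟨hx.1, hxy.le.trans hn.le⟩, huU n y ⟨hy.1, hn.le⟩]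
    exact hUa n hx.1 hy.1 hxy
  have hTb0 : 0 < Tb := (EReal.coe_lt_coe_iff.2 (hT 0)).trans (hTlt 0)
  have hu0 : u 0 = u₀ := by rw [huU 0 0 ⟨le_rfl, (hT 0).le⟩, hU0]
  have hcont : ∀ n, ContinuousOn u (Icc 0 (T n)) := fun n =>
    (hU n).continuousOn.congr (huU n)
  refine ⟨Tb, u, hTb0, ⟨hu0, ?_, hupos, ?_⟩, ?_, ?_, ?_, ?_⟩
  · intro t ht
    obtain ⟨n, hn⟩ := hex t ht.2
    refine (hcont n t ⟨ht.1, hn.le⟩).mono_of_mem_nhdsWithin ?_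
    filter_upwards [self_mem_nhdsWithin, mem_nhdsWithin_of_mem_nhds (Iio_mem_nhds hn)] with s hs hs'
    exact ⟨hs.1, le_of_lt hs'⟩
  · intro S hS hSb
    obtain ⟨n, hn⟩ := hex S hSb
    have hsub : Icc 0 S ⊆ Icc 0 (T n) := Icc_subset_Icc_right hn.le
    have hpos : ∀ t ∈ Icc 0 S, 0 < u t := fun t ht =>
      hupos t ht.1 ((EReal.coe_le_coe_iff.2 ht.2).trans_lt hSb)
    have hc := (hcont n).mono hsub
    refine FracODE.isStrongSolution_of_volterra hγ0 hγ1 hS hu0 hc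
      (FracODE.continuousOn_power_comp hc hpos) hpos fun t ht => ?_
    have ht' := hsub (Ioo_subset_Icc_self ht)
    rw [huU n t ht', hUv n t ht']
    congr 2
    exact FracODE.leftInt_congr fun s hs => by rw [huU n s ⟨hs.1.le, hs.2.le.trans ht'.2⟩]
  · intro b v _ hv
    -- The positive minimum of `v` on `[0, t]` exceeds some `ε n`, so `hcomp` identifies `v` with `U
    -- n` and places `t` before `T n`.
    have key : ∀ t : ℝ, 0 ≤ t → (t : EReal) < b → ∃ n, t ≤ T n ∧ v t = U n t := by
      intro t ht htb
      have hlt : ∀ s ∈ Icc 0 t, (s : EReal) < b := fun s hs =>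
        (EReal.coe_le_coe_iff.2 hs.2).trans_lt htb
      have hc : ContinuousOn v (Icc 0 t) := hv.continuousOn.mono fun s hs => ⟨hs.1, hlt s hs⟩
      have hpos : ∀ s ∈ Icc 0 t, 0 < v s := fun s hs => hv.mem_domain s hs.1 (hlt s hs)
      obtain ⟨y, hy, hmin⟩ := isCompact_Icc.exists_isMinOn ⟨t, ht, le_rfl⟩ hc
      obtain ⟨n, hn⟩ := (hε0.eventually (gt_mem_nhds (hpos y hy))).exists
      have hve : ∀ s ∈ Icc 0 t, v s = u₀ + 1 / Real.Gamma γ *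
          FracODE.leftInt γ (fun s => A * v s ^ p) s := fun s hs =>
        hv.volterra hγ0 hγ1 hs.1 (hlt s hs)
      have h1 := hcomp n v t ht hc (fun s hs => ⟨hn.le.trans (hmin hs),
        FracODE.volterra_le_initial hγ0 hA (fun r hr => hpos r ⟨hr.1, hr.2.trans hs.2⟩)
          (hve s hs)⟩) hve
      exact ⟨n, h1.1, h1.2 t ⟨ht, le_rfl⟩⟩
    refine ⟨?_, fun t ht htb => ?_⟩
    · by_contra! hlt
      obtain ⟨t, ht1, ht2⟩ := EReal.lt_iff_exists_real_btwn.1 hlt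
      have ht0 : 0 ≤ t := EReal.coe_nonneg.1 (hTb0.trans ht1).le
      obtain ⟨n, hn, -⟩ := key t ht0 ht2
      exact ((EReal.coe_le_coe_iff.2 hn).trans_lt (hTlt n)).not_gt ht1
    · obtain ⟨n, hn, he⟩ := key t ht htb
      rw [he, huU n t ⟨ht, hn⟩]
  · intro t ht htb
    refine ⟨hupos t ht.le htb, ?_⟩
    rw [← hu0]
    exact hanti ⟨le_rfl, hTb0⟩ ⟨ht.le, htb⟩ ht
  · exact hanti.mono fun t ht => ⟨ht.1.le, ht.2⟩
  · rw [Metric.tendsto_nhds]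
    intro δ hδ
    obtain ⟨n, hn⟩ := (hε0.eventually (gt_mem_nhds hδ)).exists
    -- The neighbourhood is `(T n, Tb)`, on which strict decrease gives `u < u (T n) = ε n < δ`;
    -- this covers finite and infinite `Tb` alike.
    refine mem_of_superset (preimage_mem_comap (inter_mem
      (mem_nhdsWithin_of_mem_nhds (Ioi_mem_nhds (hTlt n))) self_mem_nhdsWithin)) ?_
    rintro t ⟨ht1, ht2⟩
    have hTt : T n < t := EReal.coe_lt_coe_iff.1 ht1
    have ht0 : 0 ≤ t := (hT n).le.trans hTt.le
    have h1 := hanti ⟨(hT n).le, hTlt n⟩ ⟨ht0, ht2⟩ hTt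
    rw [huU n (T n) ⟨(hT n).le, le_rfl⟩, hUT n] at h1
    change dist (u t) 0 < δ
    rw [dist_zero_right, Real.norm_of_nonneg (hupos t ht0 ht2).le]
    exact h1.trans hn
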